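/- There is an absolute constant $C>0$ such that the following holds. Let $0<\varphi<1$, $\varepsilon>0$ and $a,s\in\mathbb N$. There is a quantum circuit $GPE(\varphi,\varepsilon)$, consisting of fixed unitary gates (which may depend on $\varphi,\varepsilon,a,s$) and queries to an oracle $U$, which acts on a flag qubit $\mathsf C$, an $s$-qubit register $\mathsf I$, and finitely many ancilla qubits initialized to $|0\rangle$, and which makes at most $$C\,\frac1\varphi\,\max\{1,\log(1/\varepsilon)\}$$ queries (so $O(\frac1\varphi\log\frac1\varepsilon)$ as $\varepsilon\to0$), a query being one use of controlled-$U$ or controlled-$U^\dagger$, such that for every input as follows it has the property stated below. Let $A=\sum_u\lambda_u|\phi_u\rangle\langle\phi_u|$ be a Hermitian operator on $s$ qubits, with $\lambda_u\in\mathbb R$ and $(|\phi_u\rangle)_u$ an orthonormal basis. Let $\alpha>0$ satisfy $\alpha\ge 2\|A\|$, and let $U$ be an $(\alpha,a,0)$-block-encoding of $A$, that is, a unitary on $a+s$ qubits with $A=\alpha\,(\langle 0|^{\otimes a}\otimes I)\,U\,(|0\rangle^{\otimes a}\otimes I)$. Then there are unit vectors $|\xi_u\rangle\in\mathbb C^2$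 with $$\begin{cases}\||\xi_u\rangle-|0\rangle\|\le\varepsilon, & \lambda_u/\alpha\in[\varphi,1),\\ \||\xi_u\rangle-i|1\rangle\|\le\varepsilon, & \lambda_u/\alpha\in[-\varphi/2,\varphi/2],\\ \||\xi_u\rangle+|0\rangle\|\le\varepsilon, & \lambda_u/\alpha\in(-1,-\varphi],\end{cases}$$ such that the circuit implements the isometry $$|0\rangle_{\mathsf C}|\phi_u\rangle_{\mathsf I}\mapsto|\xi_u\rangle_{\mathsf C}|\phi_u\rangle_{\mathsf I}\qquad(\text{for all }u)$$ to within $\varepsilon$ in operator norm: on the input $|0\rangle_{\mathsf C}|\psi\rangle_{\mathsf I}$ together with all ancillas in $|0\rangle$, for every vector $|\psi\rangle$, its output is within $\varepsilon\,\||\psi\rangle\|$ of $\sum_u\langle\phi_u|\psi\rangle\,|\xi_u\rangle_{\mathsf C}|\phi_u\rangle_{\mathsf I}$ together with all ancillas in $|0\rangle$. -/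

import Mathlib

open scoped Kronecker Matrix.Norms.L2Operator

/-- Computational-basis labels of an `n`-qubit register; the label of `|0⟩^{⊗ n}` is `0`. -/
abbrev Qubits (n : ℕ) : Type := Fin n → Fin 2

/-- Vectors of the Hilbert space `ℂ^ι`, with the Euclidean norm. -/
abbrev StateVec (ι : Type) : Type := EuclideanSpace ℂ ι

/-- The computational-basis vector `|i⟩`. -/
noncomputable def ket {ι : Type} [DecidableEq ι] (i : ι) : StateVec ι :=
  EuclideanSpace.single i (1 : ℂ)

/-- The tensor product `|u⟩ ⊗ |v⟩`. -/
noncomputable def tensorVec {ι κ : Type} (u : StateVec ι) (v : StateVec κ) : StateVec (ι × κ) :=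
  WithLp.toLp 2 fun p => u p.1 * v p.2

/-- The rank-one operator `|v⟩⟨v|`. -/
noncomputable def ketBra {ι : Type} (v : StateVec ι) : Matrix ι ι ℂ :=
  Matrix.of fun i j => v i * star (v j)

/-- `U`, acting on `a` ancilla qubits and `s` system qubits, is an `(α, a, ε)`-block-encoding of
the `s`-qubit operator `A`: `‖A - α ⟨0|^{⊗ a} U |0⟩^{⊗ a}‖ ≤ ε` in operator norm. -/
def IsBlockEncoding {a s : ℕ} (U : Matrix.unitaryGroup (Qubits a × Qubits s) ℂ)
    (A : Matrix (Qubits s) (Qubits s) ℂ) (α ε : ℝ) : Prop :=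
  0 < α ∧ 0 ≤ ε ∧
    ‖A - (α : ℂ) • Matrix.of fun i j => (U : Matrix _ _ ℂ) ((0 : Qubits a), i) ((0 : Qubits a), j)‖
      ≤ ε

/-- The controlled operator `|0⟩⟨0| ⊗ I + |1⟩⟨1| ⊗ M ⊗ I` on (control qubit) ⊗ `ℂ^D` ⊗ `ℂ^R`. -/
noncomputable def controlled {D : Type} (R : Type) [DecidableEq D] [DecidableEq R]
    (M : Matrix D D ℂ) : Matrix (Fin 2 × (D × R)) (Fin 2 × (D × R)) ℂ :=
  Matrix.single 0 0 1 ⊗ₖ (1 : Matrix (D × R) (D × R) ℂ) +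
    Matrix.single 1 1 1 ⊗ₖ (M ⊗ₖ (1 : Matrix R R ℂ))

/-- Quantum circuits with oracle access to an unspecified unitary on `ℂ^D`, acting on
(control qubit) ⊗ `ℂ^D` ⊗ `ℂ^R`. The gates do not depend on the oracle. -/
inductive QueryCircuit (D R : Type) [Fintype D] [DecidableEq D] [Fintype R] [DecidableEq R] : Type
  /-- a fixed unitary on the whole space -/
  | gate (V : Matrix.unitaryGroup (Fin 2 × (D × R)) ℂ) : QueryCircuit D R
  /-- one use of the controlled oracle -/
  | query : QueryCircuit D R
  /-- one use of the inverse of the controlled oracle -/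
  | queryInv : QueryCircuit D R
  /-- first `c₁`, then `c₂` -/
  | seq (c₁ c₂ : QueryCircuit D R) : QueryCircuit D R

namespace QueryCircuit

variable {D R : Type} [Fintype D] [DecidableEq D] [Fintype R] [DecidableEq R]

/-- The operator that the circuit performs when the oracle is `U`. -/
noncomputable def toMatrix (U : Matrix.unitaryGroup D ℂ) :
    QueryCircuit D R → Matrix (Fin 2 × (D × R)) (Fin 2 × (D × R)) ℂ
  | gate V => V
  | query => controlled R (U : Matrix D D ℂ)
  | queryInv => controlled R (star (U : Matrix D D ℂ))
  | seq c₁ c₂ => toMatrix U c₂ * toMatrix U c₁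

/-- The number of uses of the oracle or its inverse. -/
def numQueries : QueryCircuit D R → ℕ
  | gate _ => 0
  | query => 1
  | queryInv => 1
  | seq c₁ c₂ => numQueries c₁ + numQueries c₂

end QueryCircuit

/-- The joint vector with `|0⟩` in the control qubit, `|0⟩^{⊗ a}` in the block-encoding ancillas,
`ψ` in the system register, `ξ` in the flag qubit, and `|0⟩^{⊗ w}` in the workspace. -/
noncomputable def gpeState (a : ℕ) {s : ℕ} (w : ℕ) (ξ : StateVec (Fin 2))
    (ψ : StateVec (Qubits s)) :
    StateVec (Fin 2 × ((Qubits a × Qubits s) × (Fin 2 × Qubits w))) :=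
  tensorVec (ket 0) (tensorVec (tensorVec (ket 0) ψ) (tensorVec ξ (ket 0)))

/-!
The circuit is quantum signal processing on a qubitized walk, applied to a polynomial path of unit
vectors that sits near `-|0⟩`, `i|1⟩` and `|0⟩` on the three ranges of eigenvalues.

*The walk.* One extra qubit turns the oracle `U` into its Hermitian dilation, an involution that
costs two queries (`dilation`). Its compression by the projection `P` onto `|0⟩ ⊗ ℂ^s ⊗ |+⟩` is
`A / α`, hence the walk operator `W = (2 P - 1) · dilation U` satisfies `W + W⁻¹ = 2 λ / α` on the
vectors `|0⟩ ⊗ φ_u ⊗ |+⟩` (`walk_recurrence`). A polynomial of degree `d` in `λ / α` is therefore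
`W⁻ᵈ` times a polynomial of degree `2 d` in `W` there (`joukowski`).

*Signal processing.* A vector of polynomials of unit length on the circle has orthogonal lowest and
highest coefficients, so that a factor `(1 - Q) + z Q`, with `Q` a projection, can be split off and
the degree drops (`exists_layer_stripping`). Each factor is a walk step controlled on `Q`, which
gives a circuit with two queries per degree for the whole vector (`exists_implements_aeval`).
Followed by a power of `W⁻¹`, it realizes every polynomial path `x ↦ (P₀ x, P₁ x)` in `ℂ²` for which
the missing length `1 - |P₀|² - |P₁|²` is `f² + (1 - x²) h²`; the latter is put on a third basis
vector (`exists_circuit_of_path`). By Lukács' theorem, positivity of the missing length on `[-1, 1]`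
suffices (`exists_sq_add_one_sub_sq_mul_sq`).

*The path.* A sign approximation `c` that crosses over at `σ` is completed to a unit vector
`(c, f, √(1 - x²) h)`, again by Lukács' theorem, and `√(1 - x²)` is replaced by a polynomial that
approximates it from below, uniformly on `[-1/2, 1/2]` (`exists_axis_path`). This is where
`2 ‖A‖ ≤ α` is needed: near `±1` the square root has no good polynomial approximation. Nothing is
known about `f` and `h`, except that they are small where `c` is near `±1`. Therefore the path is
not used directly; its values are read as imaginary quaternions `γ₊`, `γ₋`, for `σ = ±3φ/4`, which
are near `±i` on the three ranges, and the product `(1 + γ₊) (1 + γ₋) / 2` is near `-i`, `1` and `i`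
there. It has almost unit length throughout `[-1/2, 1/2]` (`exists_quaternion_path`).

*The degree.* The sign approximation is the normalized primitive of the kernel `(T_k(t) / t) ^ (2n)`
with `k` of order `1 / φ`. The fraction of its mass outside the gap is `O(4⁻ⁿ)` without any factor
`1 / φ`, so that accuracy `ε` needs only `n = O(log (1 / ε))` and degree `O(k n)`
(`exists_sign_approx`).

*The error.* Eigenvalues of `A / α` lie in `[-1/2, 1/2]`, where the path `y` has length at least
`1 - O(ε²)`; `ξ_u` is `y` normalized. The outputs of the circuit on the eigenvectors and the target
vectors are both orthonormal families, with mutual inner products `δ_{u u'} ‖y_u‖`, and this alone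
bounds the distance of the isometries (`norm_sum_sub_sum_sq_le`). What the circuit does in
the orthogonal complement of the target space is irrelevant.
-/

/-! ### Positive polynomials on `[-1, 1]` -/

/-- A quadratic `a x² + b x + c` that is positive on `[-1, 1]` is `(α x + γ)² + τ² (1 - x²)`.
The coefficients are forced by the values at `±1`: `(α ± γ)²` are the values at `±1`. -/
lemma exists_sq_add_of_quadratic_pos {a b c : ℝ}
    (h : ∀ x ∈ Set.Icc (-1 : ℝ) 1, 0 < a * x ^ 2 + b * x + c) :
    ∃ α γ τ : ℝ, a = α ^ 2 - τ ^ 2 ∧ b = 2 * α * γ ∧ c = γ ^ 2 + τ ^ 2 := by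
  have h1 : 0 < a + b + c := by simpa using h 1 (by simp)
  have h2 : 0 < a - b + c := by simpa [sub_eq_add_neg] using h (-1) (by simp)
  set u := √(a + b + c)
  set v := √(a - b + c)
  have hu : u ^ 2 = a + b + c := Real.sq_sqrt h1.le
  have hv : v ^ 2 = a - b + c := Real.sq_sqrt h2.le
  have hu0 : 0 < u := Real.sqrt_pos.2 h1
  have hv0 : 0 < v := Real.sqrt_pos.2 h2
  have ht : 0 ≤ (c - a + u * v) / 2 := by
    rcases le_total a c with hac | hac
    · have := mul_pos hu0 hv0
      linarith
    · have hb : |b| < a + c := by rw [abs_lt]; constructor <;> linarith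
      rcases le_or_gt a 0 with ha | ha
      · linarith [abs_nonneg b]
      -- The vertex lies in `[-1, 1]`, so positivity there bounds the discriminant.
      have hdisc : b ^ 2 < 4 * a * c := by
        have hb' := abs_lt.1 hb
        have := h (-b / (2 * a)) ⟨by rw [le_div_iff₀ (by linarith)]; linarith,
          by rw [div_le_iff₀ (by linarith)]; linarith⟩
        have e : a * (-b / (2 * a)) ^ 2 + b * (-b / (2 * a)) + c =
            (4 * a * c - b ^ 2) / (4 * a) := by
          field_simp; ring
        rw [e] at this
        have := (div_pos_iff_of_pos_right (by linarith)).1 this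
        linarith
      have : (a - c) ^ 2 ≤ (u * v) ^ 2 := by
        rw [mul_pow, hu, hv]; nlinarith
      have := abs_le_of_sq_le_sq' this (mul_pos hu0 hv0).le
      linarith [this.2]
  have hτ := Real.sq_sqrt ht
  refine ⟨(u + v) / 2, (u - v) / 2, √((c - a + u * v) / 2), ?_, ?_, ?_⟩
  · rw [hτ]; linear_combination (-1/4) * hu - (1/4) * hv
  · linear_combination (-1/2) * hu + (1/2) * hv
  · rw [hτ]; linear_combination (-1/4) * hu - (1/4) * hv

open Polynomial in
/-- **Lukács' theorem**, for strictly positive polynomials. The representable polynomials are closed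
under products by Brahmagupta's identity, and every irreducible factor has degree at most two and
constant sign on `[-1, 1]`. -/
theorem exists_sq_add_one_sub_sq_mul_sq (N : ℝ[X])
    (hN : ∀ x ∈ Set.Icc (-1 : ℝ) 1, 0 < N.eval x) :
    ∃ f h : ℝ[X], N = f ^ 2 + (1 - X ^ 2) * h ^ 2 ∧
      f.natDegree ≤ 2 * N.natDegree ∧ h.natDegree ≤ 2 * N.natDegree := by
  induction hn : N.natDegree using Nat.strong_induction_on generalizing N with
  | _ n ih =>
  rcases Nat.eq_zero_or_pos n with rfl | hpos
  · obtain ⟨a, rfl⟩ := natDegree_eq_zero.1 hn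
    have ha : 0 < a := by simpa using hN 0 (by simp)
    refine ⟨C √a, 0, ?_, by simp, by simp⟩
    rw [← C_pow, Real.sq_sqrt ha.le]; simp
  · have hN0 : N ≠ 0 := by rintro rfl; simp at hn; omega
    have hNu : ¬ IsUnit N := fun hu => by
      rw [natDegree_eq_zero_of_isUnit hu] at hn; omega
    obtain ⟨g, hg, M, rfl⟩ := WfDvdMonoid.exists_irreducible_factor hNu hN0
    have hM0 : M ≠ 0 := right_ne_zero_of_mul hN0
    have hsign : (∀ x ∈ Set.Icc (-1 : ℝ) 1, 0 < g.eval x) ∨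
        (∀ x ∈ Set.Icc (-1 : ℝ) 1, g.eval x < 0) := by
      have hne : ∀ x ∈ Set.Icc (-1 : ℝ) 1, g.eval x ≠ 0 := fun x hx h0 => by
        have := hN x hx
        simp [h0] at this
      by_contra! hcon
      obtain ⟨⟨x, hx, hx'⟩, ⟨y, hy, hy'⟩⟩ := hcon
      obtain ⟨z, hz, hz'⟩ := isPreconnected_Icc.intermediate_value hx hy
        g.continuous.continuousOn ⟨hx', hy'⟩
      exact hne z hz hz'
    obtain ⟨g', M', hgM, hg'd, hM'd, hg'⟩ : ∃ g' M' : ℝ[X], g * M = g' * M' ∧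
        g'.natDegree = g.natDegree ∧ M'.natDegree = M.natDegree ∧
        ∀ x ∈ Set.Icc (-1 : ℝ) 1, 0 < g'.eval x := by
      rcases hsign with hs | hs
      · exact ⟨g, M, rfl, rfl, rfl, hs⟩
      · exact ⟨-g, -M, by ring, natDegree_neg _, natDegree_neg _, fun x hx => by
          simpa using hs x hx⟩
    have hM' : ∀ x ∈ Set.Icc (-1 : ℝ) 1, 0 < M'.eval x := fun x hx => by
      have := hN x hx
      rw [hgM, eval_mul] at this
      exact (pos_iff_pos_of_mul_pos this).1 (hg' x hx)
    have hdeg : g.natDegree + M.natDegree = n := by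
      rw [← hn, natDegree_mul hg.ne_zero hM0]
    have hgpos : 0 < g.natDegree := hg.natDegree_pos
    obtain ⟨f, h, hM'e, hfd, hhd⟩ := ih M'.natDegree (by omega) M' hM' rfl
    have hg2 : g'.degree ≤ 2 := by
      have := natDegree_le_iff_degree_le.2 hg.degree_le_two
      exact natDegree_le_iff_degree_le.1 (by omega)
    have hq := eq_quadratic_of_degree_le_two hg2
    obtain ⟨α, γ, τ, ha, hb, hc⟩ := exists_sq_add_of_quadratic_pos
      (a := g'.coeff 2) (b := g'.coeff 1) (c := g'.coeff 0) (fun x hx => by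
        have := hg' x hx
        rw [hq] at this
        simpa using this)
    have hge : g' = (C α * X + C γ) ^ 2 + (1 - X ^ 2) * (C τ) ^ 2 := by
      rw [hq, ha, hb, hc]; simp only [C_sub, C_add, C_mul, C_pow]
      rw [show (C (2 : ℝ)) = (2 : ℝ[X]) from rfl]; ring
    refine ⟨(C α * X + C γ) * f - (1 - X ^ 2) * (C τ * h), (C α * X + C γ) * h + C τ * f,
      ?_, ?_, ?_⟩
    · rw [hgM, hge, hM'e]; ring
    · refine (natDegree_sub_le _ _).trans (max_le ?_ ?_)
      · have : (C α * X + C γ).natDegree ≤ 1 := natDegree_linear_le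
        exact natDegree_mul_le.trans (by omega)
      · have h1 : (1 - X ^ 2 : ℝ[X]).natDegree ≤ 2 := by compute_degree
        have h2 : (C τ * h).natDegree ≤ h.natDegree := natDegree_C_mul_le _ _
        exact natDegree_mul_le.trans (by omega)
    · refine (natDegree_add_le _ _).trans (max_le ?_ ?_)
      · have : (C α * X + C γ).natDegree ≤ 1 := natDegree_linear_le
        exact natDegree_mul_le.trans (by omega)
      · exact (natDegree_C_mul_le _ _).trans (by omega)

/-! ### Polynomial approximations of `√(1 - x²)` and of the sign function -/

open Polynomial in
/-- The Taylor polynomial of degree `n` of `(1 - t) ^ (-1 / 2)`. -/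
noncomputable def invSqrtTaylor (n : ℕ) : ℝ[X] :=
  ∑ k ∈ Finset.range (n + 1), C ((k.centralBinom : ℝ) / 4 ^ k) * X ^ k

open Polynomial in
/-- The Taylor polynomial satisfies the differential equation `(1 - t) y' = y / 2` of
`(1 - t) ^ (-1 / 2)` up to its last term. -/
lemma derivative_invSqrtTaylor (n : ℕ) :
    2 * ((1 - X) * derivative (invSqrtTaylor n)) = invSqrtTaylor n -
      C ((2 * n + 1) * ((n.centralBinom : ℝ) / 4 ^ n)) * X ^ n := by
  induction n with
  | zero => simp [invSqrtTaylor]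
  | succ n ih =>
    have hs : invSqrtTaylor (n + 1) = invSqrtTaylor n +
        C (((n + 1).centralBinom : ℝ) / 4 ^ (n + 1)) * X ^ (n + 1) := by
      rw [invSqrtTaylor, Finset.sum_range_succ, ← invSqrtTaylor]
    have hb : ((n : ℝ) + 1) * ((n + 1).centralBinom : ℝ) = 2 * (2 * n + 1) * n.centralBinom := by
      exact_mod_cast Nat.succ_mul_centralBinom_succ n
    have hb' : (C ((2 * n + 1) * ((n.centralBinom : ℝ) / 4 ^ n)) : ℝ[X]) =
        2 * ((n : ℝ[X]) + 1) * C (((n + 1).centralBinom : ℝ) / 4 ^ (n + 1)) := by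
      rw [show (2 * ((n : ℝ[X]) + 1)) = C (2 * ((n : ℝ) + 1)) by
        simp [show (C (2 : ℝ)) = (2 : ℝ[X]) from rfl], ← C_mul]
      congr 1
      rw [pow_succ]; field_simp; linear_combination (-2) * hb
    rw [hs]
    simp only [derivative_add, derivative_C_mul, derivative_X_pow]
    rw [mul_add, mul_add, ih, hb']
    simp only [C_mul, C_add]
    push_cast
    rw [show (C (2 : ℝ)) = (2 : ℝ[X]) from rfl]
    simp
    ring

lemma eval_invSqrtTaylor_nonneg (n : ℕ) {t : ℝ} (ht : 0 ≤ t) : 0 ≤ (invSqrtTaylor n).eval t := by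
  simp only [invSqrtTaylor, Polynomial.eval_finsetSum, Polynomial.eval_mul, Polynomial.eval_C,
    Polynomial.eval_pow, Polynomial.eval_X]
  positivity

lemma hasDerivAt_one_sub_mul_invSqrtTaylor_sq (n : ℕ) (t : ℝ) :
    HasDerivAt (fun t => (1 - t) * (invSqrtTaylor n).eval t ^ 2)
      (-((2 * n + 1) * ((n.centralBinom : ℝ) / 4 ^ n) * t ^ n * (invSqrtTaylor n).eval t)) t := by
  have h1 := (invSqrtTaylor n).hasDerivAt t
  have h2 := ((hasDerivAt_id t).const_sub 1).mul (h1.pow 2)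
  have h3 := congrArg (Polynomial.eval t) (derivative_invSqrtTaylor n)
  simp only [Polynomial.eval_mul, Polynomial.eval_sub, Polynomial.eval_one, Polynomial.eval_X,
    Polynomial.eval_C, Polynomial.eval_pow, Polynomial.eval_ofNat] at h3
  refine h2.congr_deriv ?_
  simp only [id, Pi.pow_apply, Nat.cast_ofNat, Nat.add_one_sub_one, pow_one]
  linear_combination (Polynomial.eval t (invSqrtTaylor n)) * h3

/-- The Taylor polynomials of `(1 - t) ^ (-1 / 2)` approximate it from below. -/
lemma one_sub_mul_invSqrtTaylor_sq_le (n : ℕ) {t : ℝ} (ht : 0 ≤ t) :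
    (1 - t) * (invSqrtTaylor n).eval t ^ 2 ≤ 1 := by
  have hd := hasDerivAt_one_sub_mul_invSqrtTaylor_sq n
  have hanti : AntitoneOn (fun t => (1 - t) * (invSqrtTaylor n).eval t ^ 2) (Set.Ici 0) := by
    refine antitoneOn_of_deriv_nonpos (convex_Ici 0)
      (fun x _ => (hd x).continuousAt.continuousWithinAt)
      (fun x _ => (hd x).differentiableAt.differentiableWithinAt) (fun x hx => ?_)
    rw [interior_Ici, Set.mem_Ioi] at hx
    rw [(hd x).deriv, neg_nonpos]
    have := eval_invSqrtTaylor_nonneg n hx.le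
    positivity
  refine (hanti Set.self_mem_Ici ht ht).trans ?_
  simp [invSqrtTaylor, Polynomial.eval_finsetSum, Finset.sum_range_succ']

/-- The error of the Taylor polynomials, from the derivative of `(1 - t) y²`, which is only of the
order of `t ^ n`. -/
lemma le_one_sub_mul_invSqrtTaylor_sq (n : ℕ) {t : ℝ} (ht : 0 ≤ t) (ht' : t ≤ 1 / 4) :
    1 - 4 * t ^ (n + 1) ≤ (1 - t) * (invSqrtTaylor n).eval t ^ 2 := by
  have hd (x : ℝ) : HasDerivAt
      (fun t => (1 - t) * (invSqrtTaylor n).eval t ^ 2 + 4 * t ^ (n + 1)) _ x :=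
    (hasDerivAt_one_sub_mul_invSqrtTaylor_sq n x).add
    ((hasDerivAt_pow (n + 1) x).const_mul 4)
  have hmono : MonotoneOn (fun t => (1 - t) * (invSqrtTaylor n).eval t ^ 2 + 4 * t ^ (n + 1))
      (Set.Icc 0 (1 / 4)) := by
    refine monotoneOn_of_deriv_nonneg (convex_Icc _ _)
      (fun x _ => (hd x).continuousAt.continuousWithinAt)
      (fun x _ => (hd x).differentiableAt.differentiableWithinAt) (fun x hx => ?_)
    rw [interior_Icc, Set.mem_Ioo] at hx
    rw [(hd x).deriv]
    have h0 := eval_invSqrtTaylor_nonneg n hx.1.le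
    have h1 := one_sub_mul_invSqrtTaylor_sq_le n hx.1.le
    have h2 : (invSqrtTaylor n).eval x ≤ 2 := by
      by_contra! hcon
      nlinarith [hx.2]
    have h3 : (n.centralBinom : ℝ) / 4 ^ n ≤ 1 := by
      rw [div_le_one (by positivity)]
      exact_mod_cast Nat.centralBinom_le_four_pow n
    have h4 : (n.centralBinom : ℝ) / 4 ^ n * (invSqrtTaylor n).eval x ≤ 1 * 2 :=
      mul_le_mul h3 h2 h0 (by norm_num)
    have h5 : 0 ≤ x ^ n := pow_nonneg hx.1.le n
    have h6 : (2 * (n : ℝ) + 1) * ((n.centralBinom : ℝ) / 4 ^ n * (invSqrtTaylor n).eval x) ≤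
        (2 * n + 1) * 2 := by nlinarith [n.cast_nonneg (α := ℝ)]
    push_cast
    nlinarith
  have := hmono (Set.left_mem_Icc.2 (by norm_num)) ⟨ht, ht'⟩ ht
  simp only at this
  rw [show (1 - (0 : ℝ)) * (invSqrtTaylor n).eval 0 ^ 2 + 4 * 0 ^ (n + 1) = 1 by
    simp [invSqrtTaylor, Polynomial.eval_finsetSum, Finset.sum_range_succ']] at this
  linarith

open Polynomial in
/-- Polynomials approximating `√(1 - x²)` from below, uniformly on `[-1/2, 1/2]`. -/
lemma exists_sqrt_one_sub_sq_approx (n : ℕ) :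
    ∃ s : ℝ[X], s.natDegree ≤ 2 * n + 2 ∧
      (∀ x ∈ Set.Icc (-1 : ℝ) 1, s.eval x ^ 2 ≤ 1 - x ^ 2) ∧
      ∀ x ∈ Set.Icc (-(1 / 2) : ℝ) (1 / 2), 1 - x ^ 2 - (1 / 4) ^ n ≤ s.eval x ^ 2 := by
  -- `√(1 - x²) = (1 - x²) (1 - x²) ^ (-1 / 2)`
  refine ⟨(1 - X ^ 2) * (invSqrtTaylor n).comp (X ^ 2), ?_, fun x hx => ?_, fun x hx => ?_⟩
  · have h1 : (1 - X ^ 2 : ℝ[X]).natDegree ≤ 2 := by compute_degree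
    have h2 : (invSqrtTaylor n).natDegree ≤ n := by
      refine natDegree_sum_le_of_forall_le _ _ fun k hk => ?_
      exact (natDegree_C_mul_X_pow_le _ _).trans (by simpa [Nat.lt_succ_iff] using hk)
    have h3 : ((invSqrtTaylor n).comp (X ^ 2)).natDegree ≤ n * 2 :=
      natDegree_comp_le.trans (by simpa using h2)
    exact natDegree_mul_le.trans (by omega)
  · have := one_sub_mul_invSqrtTaylor_sq_le n (sq_nonneg x)
    have hx2 : x ^ 2 ≤ 1 := by nlinarith [hx.1, hx.2]
    simp only [eval_mul, eval_sub, eval_one, eval_pow, eval_X, eval_comp]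
    nlinarith
  · have hx2 : x ^ 2 ≤ 1 / 4 := by nlinarith [hx.1, hx.2]
    have h1 := le_one_sub_mul_invSqrtTaylor_sq n (sq_nonneg x) hx2
    have h2 : (x ^ 2) ^ (n + 1) ≤ (1 / 4) ^ (n + 1) := pow_le_pow_left₀ (sq_nonneg x) hx2 _
    have h3 : (0 : ℝ) ≤ (1 / 4) ^ n := by positivity
    simp only [eval_mul, eval_sub, eval_one, eval_pow, eval_X, eval_comp]
    have h4 : 1 - (1 / 4) ^ n ≤ (1 - x ^ 2) * eval (x ^ 2) (invSqrtTaylor n) ^ 2 := by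
      rw [pow_succ (1 / 4 : ℝ)] at h2
      linarith
    have h5 := mul_le_mul_of_nonneg_left h4 (by linarith : (0 : ℝ) ≤ 1 - x ^ 2)
    nlinarith [mul_nonneg h3 (sq_nonneg x)]

open Polynomial in
lemma exists_derivative_eq (K : ℝ[X]) :
    ∃ P : ℝ[X], derivative P = K ∧ P.natDegree ≤ K.natDegree + 1 := by
  refine ⟨∑ i ∈ Finset.range (K.natDegree + 1), C (K.coeff i / (i + 1)) * X ^ (i + 1), ?_, ?_⟩
  · conv_rhs => rw [K.as_sum_range_C_mul_X_pow]
    rw [derivative_sum]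
    refine Finset.sum_congr rfl fun i _ => ?_
    rw [derivative_C_mul_X_pow]
    congr 2
    have : (i : ℝ) + 1 ≠ 0 := by positivity
    push_cast
    field_simp
  · refine natDegree_sum_le_of_forall_le _ _ fun i hi => ?_
    refine (natDegree_C_mul_X_pow_le _ _).trans ?_
    have := Finset.mem_range.1 hi
    omega

open Polynomial in
/-- The polynomial `T_k(t) / t` for odd `k`, a sharp peak at the origin: with `t = sin τ`, its
numerator is `± sin (k τ)`. -/
lemma exists_chebyshev_div (m : ℕ) : ∃ q : ℝ[X], q.natDegree ≤ 2 * m ∧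
    (∀ t ∈ Set.Icc (-1 : ℝ) 1, |t * q.eval t| ≤ 1) ∧
    ∀ t ∈ Set.Ioc (0 : ℝ) (1 / (2 * m + 1)), (2 * m + 1) / 2 ≤ |q.eval t| := by
  set k : ℤ := 2 * m + 1 with hk
  have hodd : Odd k := ⟨m, rfl⟩
  have h0 : (Chebyshev.T ℝ k).coeff 0 = 0 := by
    rw [coeff_zero_eq_eval_zero, Chebyshev.T_eval_zero_of_odd ℝ hodd]
  have hX : X * (Chebyshev.T ℝ k).divX = Chebyshev.T ℝ k := by
    have := X_mul_divX_add (Chebyshev.T ℝ k)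
    rwa [h0, C_0, add_zero] at this
  have heval (t : ℝ) : t * (Chebyshev.T ℝ k).divX.eval t = (Chebyshev.T ℝ k).eval t := by
    conv_rhs => rw [← hX]
    simp
  refine ⟨(Chebyshev.T ℝ k).divX, ?_, fun t ht => ?_, fun t ht => ?_⟩
  · rw [natDegree_divX_eq_natDegree_tsub_one, Chebyshev.natDegree_T]
    omega
  · rw [heval]
    exact Chebyshev.abs_eval_T_real_le_one k (abs_le.2 ht)
  · obtain ⟨ht0, ht1⟩ := ht
    have hkR : (k : ℝ) = 2 * m + 1 := by simp [hk]
    have hkpos : (0 : ℝ) < 2 * m + 1 := by positivity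
    have ht2 : t * (2 * m + 1) ≤ 1 := by rwa [le_div_iff₀ hkpos] at ht1
    have ht3 : t ≤ 1 := by nlinarith [m.cast_nonneg (α := ℝ)]
    set τ := Real.arcsin t
    have hst : Real.sin τ = t := Real.sin_arcsin (by linarith) ht3
    have hτ0 : 0 ≤ τ := Real.arcsin_nonneg.2 ht0.le
    have hτ1 : τ ≤ Real.pi / 2 := Real.arcsin_le_pi_div_two t
    have hτt : t ≤ τ := hst ▸ Real.sin_le hτ0
    have hpi := Real.pi_pos
    have hJ : 2 / Real.pi * τ ≤ t := hst ▸ Real.mul_le_sin hτ0 hτ1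
    have hkτ : (2 * m + 1) * τ ≤ Real.pi / 2 := by
      have : τ ≤ Real.pi / 2 * t := by
        have := mul_le_mul_of_nonneg_left hJ (by positivity : 0 ≤ Real.pi / 2)
        have e : Real.pi / 2 * (2 / Real.pi * τ) = τ := by field_simp
        linarith
      nlinarith
    have hT : |(Chebyshev.T ℝ k).eval t| = Real.sin ((2 * m + 1) * τ) := by
      rw [← hst, ← Real.cos_pi_div_two_sub, Chebyshev.T_real_cos, hkR,
        show (2 * (m : ℝ) + 1) * (Real.pi / 2 - τ) =
          Real.pi / 2 - (2 * m + 1) * τ + m * Real.pi by ring,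
        Real.cos_add_nat_mul_pi, Real.cos_pi_div_two_sub, abs_mul, abs_pow, abs_neg, abs_one,
        one_pow, one_mul, abs_of_nonneg]
      exact Real.sin_nonneg_of_nonneg_of_le_pi (by positivity) (by linarith)
    have hsin := Real.mul_le_sin (by positivity : 0 ≤ (2 * m + 1) * τ) hkτ
    have h2pi : (1 : ℝ) / 2 ≤ 2 / Real.pi := by
      rw [div_le_div_iff₀ (by norm_num) hpi]; linarith [Real.pi_le_four]
    have hlow : (2 * m + 1) / 2 * t ≤ |(Chebyshev.T ℝ k).eval t| := by
      rw [hT]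
      refine le_trans ?_ hsin
      have : 1 / 2 * ((2 * m + 1) * τ) ≤ 2 / Real.pi * ((2 * m + 1) * τ) := by gcongr
      nlinarith
    rw [← heval, abs_mul, abs_of_pos ht0, mul_comm] at hlow
    exact le_of_mul_le_mul_left hlow ht0

open Polynomial in
/-- Approximation of the sign function outside `(-g, g)`: the normalized primitive of the
`2 n`-th power of the peak `T_k(t) / t`, with `k` of order `1 / g`. The mass of the kernel outside
the gap is a fraction `O(4⁻ⁿ)` of the total, without any factor `1 / g`. -/
lemma exists_sign_approx {g : ℝ} (hg : 0 < g) (hg1 : g ≤ 1) {n : ℕ} (hn : 1 ≤ n) :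
    ∃ c : ℝ[X], (c.natDegree : ℝ) ≤ 20 * n / g ∧ (∀ y ∈ Set.Icc (-1 : ℝ) 1, |c.eval y| ≤ 1) ∧
      (∀ y ∈ Set.Icc g 1, 1 - 14 * (1 / 4) ^ n ≤ c.eval y) ∧
      ∀ y ∈ Set.Icc (-1) (-g), c.eval y ≤ -1 + 14 * (1 / 4) ^ n := by
  -- `k = 2 m + 1` is chosen such that the height `k / 2` of the peak is at least `2 / g`, twice the
  -- bound `1 / t` at the edge of the gap.
  obtain ⟨m, hm1, hm2⟩ : ∃ m : ℕ, 4 ≤ (2 * m + 1) * g ∧ (2 * m + 1) * g ≤ 7 := by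
    refine ⟨⌈2 / g⌉₊, ?_, ?_⟩
    · have := Nat.le_ceil (2 / g)
      rw [div_le_iff₀ hg] at this
      nlinarith
    · have := (Nat.ceil_lt_add_one (by positivity : 0 ≤ 2 / g)).le
      have := mul_le_mul_of_nonneg_right this hg.le
      rw [add_mul, div_mul_cancel₀ _ hg.ne'] at this
      nlinarith
  obtain ⟨q, hqd, hq1, hq2⟩ := exists_chebyshev_div m
  obtain ⟨P, hPK, hPd⟩ := exists_derivative_eq (q ^ (2 * n))
  have hderiv (t : ℝ) : HasDerivAt (fun t => P.eval t) (q.eval t ^ (2 * n)) t := by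
    simpa [hPK] using P.hasDerivAt t
  have hmono : Monotone fun t => P.eval t := monotone_of_hasDerivAt_nonneg hderiv
    fun t => by simpa [pow_mul] using pow_nonneg (sq_nonneg _) n
  set k : ℝ := 2 * m + 1 with hk
  have hk0 : 0 < k := by positivity
  set L : ℝ := g * (1 / g) ^ (2 * n) with hL
  -- Outside the gap the kernel is at most `t ^ (-2 n) ≤ L g / t²`, whose primitive is `-L g / t`.
  have htail (s : Set ℝ) (hs : Convex ℝ s) (hsg : ∀ t ∈ s, g ≤ |t| ∧ |t| ≤ 1) {a b : ℝ}
      (ha : a ∈ s) (hb : b ∈ s) (hab : a ≤ b) :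
      P.eval b - P.eval a ≤ L * g * (a⁻¹ - b⁻¹) := by
    have hne : ∀ t ∈ s, t ≠ 0 := fun t ht h0 => by
      have := (hsg t ht).1
      rw [h0, abs_zero] at this; linarith
    have hd (t : ℝ) (ht : t ∈ s) :
        HasDerivAt (fun t => P.eval t + L * g * t⁻¹) _ t :=
      (hderiv t).add ((hasDerivAt_inv (hne t ht)).const_mul (L * g))
    have hanti : AntitoneOn (fun t => P.eval t + L * g * t⁻¹) s := by
      refine antitoneOn_of_deriv_nonpos hs (fun x hx => (hd x hx).continuousAt.continuousWithinAt)
        (fun x hx => (hd x (interior_subset hx)).differentiableAt.differentiableWithinAt)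
        (fun x hx => ?_)
      have hxs := interior_subset hx
      rw [(hd x hxs).deriv]
      obtain ⟨h1, h2⟩ := hsg x hxs
      have hx0 : 0 < |x| := hg.trans_le h1
      have h3 := hq1 x (abs_le.1 h2)
      have h4 : |q.eval x| ≤ 1 / |x| := by
        rw [abs_mul] at h3
        rwa [le_div_iff₀ hx0, mul_comm]
      have h5 : q.eval x ^ (2 * n) ≤ (1 / |x|) ^ (2 * n) := by
        rw [← (even_two_mul n).pow_abs]
        exact pow_le_pow_left₀ (abs_nonneg _) h4 _
      have h6 : (1 / |x|) ^ (2 * n) ≤ L * g * (x ^ 2)⁻¹ := by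
        obtain ⟨j, rfl⟩ : ∃ j, n = j + 1 := ⟨n - 1, by omega⟩
        have e1 : L * g = (1 / g) ^ (2 * j) := by
          rw [hL, show 2 * (j + 1) = 2 * j + 2 by ring, pow_add]; field_simp
        rw [e1, show 2 * (j + 1) = 2 * j + 2 by ring, pow_add, ← sq_abs x, one_div_pow |x| 2,
          one_div (|x| ^ 2)]
        gcongr
      linarith
    have := hanti ha hb hab
    simp only at this
    linarith
  have hLpos : 0 < L := by positivity
  -- The interval `[0, 1 / k]` alone contributes `(k / 2) ^ (2 n) / k`.
  have htotal : (k / 2) ^ (2 * n) / k ≤ P.eval 1 - P.eval (-1) := by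
    have hd (t : ℝ) : HasDerivAt (fun t => P.eval t - (k / 2) ^ (2 * n) * t) _ t :=
      (hderiv t).sub ((hasDerivAt_id t).const_mul _)
    have hmono' : MonotoneOn (fun t => P.eval t - (k / 2) ^ (2 * n) * t) (Set.Icc 0 (1 / k)) := by
      refine monotoneOn_of_deriv_nonneg (convex_Icc _ _)
        (fun x _ => (hd x).continuousAt.continuousWithinAt)
        (fun x _ => (hd x).differentiableAt.differentiableWithinAt) (fun x hx => ?_)
      rw [interior_Icc] at hx
      rw [(hd x).deriv, mul_one, sub_nonneg, ← (even_two_mul n).pow_abs (q.eval x)]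
      exact pow_le_pow_left₀ (by positivity) (hq2 x ⟨hx.1, hx.2.le⟩) _
    have h1 := hmono' (Set.left_mem_Icc.2 (by positivity)) (Set.right_mem_Icc.2 (by positivity))
      (by positivity : (0 : ℝ) ≤ 1 / k)
    simp only [mul_zero, sub_zero, mul_one_div] at h1
    have hk1 : 1 / k ≤ 1 := by
      rw [div_le_one hk0, hk]; linarith [m.cast_nonneg (α := ℝ)]
    have h2 := hmono hk1
    have h3 := hmono (by norm_num : (-1 : ℝ) ≤ 0)
    simp only at h2 h3
    linarith
  set T := P.eval 1 - P.eval (-1) with hT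
  have hTpos : 0 < T := lt_of_lt_of_le (by positivity) htotal
  have hratio : L / T ≤ 7 * (1 / 4) ^ n := by
    rw [div_le_iff₀ hTpos]
    have h1 : L ≤ 7 * (1 / 4) ^ n * ((k / 2) ^ (2 * n) / k) := by
      have e : 7 * (1 / 4) ^ n * ((k / 2) ^ (2 * n) / k) =
          7 / (k * g) * (k * g / 4) ^ (2 * n) * L := by
        rw [hL, show (1 / 4 : ℝ) ^ n = (1 / 2) ^ (2 * n) by rw [pow_mul]; norm_num]
        have : (k * g / 4) ^ (2 * n) * (1 / g) ^ (2 * n) =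
            (1 / 2) ^ (2 * n) * (k / 2) ^ (2 * n) := by
          rw [← mul_pow, ← mul_pow]; congr 1; field_simp; norm_num
        have h2 : 7 / (k * g) * (k * g / 4) ^ (2 * n) * (g * (1 / g) ^ (2 * n)) =
          7 / (k * g) * g * ((k * g / 4) ^ (2 * n) * (1 / g) ^ (2 * n)) := by ring
        rw [h2, this]
        field_simp
      rw [e]
      have h2 : 1 ≤ 7 / (k * g) := by rw [le_div_iff₀ (by positivity)]; linarith
      have h3 : 1 ≤ (k * g / 4) ^ (2 * n) := one_le_pow₀ (by linarith)
      nlinarith [mul_le_mul h2 h3 zero_le_one (by linarith)]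
    exact h1.trans (by gcongr)
  have hceval (y : ℝ) : (C (2 / T) * (P - C (P.eval (-1))) - 1).eval y =
      2 / T * (P.eval y - P.eval (-1)) - 1 := by simp
  have hceval' (y : ℝ) : (C (2 / T) * (P - C (P.eval (-1))) - 1).eval y =
      1 - 2 / T * (P.eval 1 - P.eval y) := by
    rw [hceval]
    have : 2 / T * T = 2 := div_mul_cancel₀ _ hTpos.ne'
    linear_combination this + 2 / T * hT
  have hsmall {d : ℝ} (hd : d ≤ L) : 2 / T * d ≤ 14 * (1 / 4) ^ n := by
    calc 2 / T * d ≤ 2 / T * L := by gcongr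
      _ = 2 * (L / T) := by ring
      _ ≤ _ := by linarith
  refine ⟨C (2 / T) * (P - C (P.eval (-1))) - 1, ?_, fun y hy => ?_, fun y hy => ?_, fun y hy => ?_⟩
  · have h1 : (C (2 / T) * (P - C (P.eval (-1))) - 1).natDegree ≤ 4 * m * n + 1 := by
      refine (natDegree_sub_le _ _).trans (max_le ?_ (by simp))
      refine (natDegree_C_mul_le _ _).trans ((natDegree_sub_le _ _).trans (max_le ?_ (by simp)))
      refine hPd.trans (Nat.succ_le_succ ?_)
      refine natDegree_pow_le.trans ((Nat.mul_le_mul_left _ hqd).trans (by linarith))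
    have h2 : ((C (2 / T) * (P - C (P.eval (-1))) - 1).natDegree : ℝ) ≤ 4 * m * n + 1 := by
      exact_mod_cast h1
    have hnR : (1 : ℝ) ≤ n := by exact_mod_cast hn
    have h3 : (4 * m * n + 1 : ℝ) ≤ 2 * k * n := by rw [hk]; linarith
    rw [le_div_iff₀ hg]
    nlinarith
  · have hy1 := hmono hy.1
    have hy2 := hmono hy.2
    simp only at hy1 hy2
    rw [abs_le]
    constructor
    · rw [hceval]
      have : 0 ≤ 2 / T * (P.eval y - P.eval (-1)) := mul_nonneg (by positivity) (by linarith)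
      linarith
    · rw [hceval']
      have : 0 ≤ 2 / T * (P.eval 1 - P.eval y) := mul_nonneg (by positivity) (by linarith)
      linarith
  · rw [hceval']
    have := htail (Set.Icc g 1) (convex_Icc _ _)
      (fun t ht => by rw [abs_of_nonneg (by linarith [ht.1])]; exact ht) hy
      (Set.right_mem_Icc.2 hg1) hy.2
    have hy0 : 0 < y := hg.trans_le hy.1
    have hinv : y⁻¹ ≤ g⁻¹ := inv_anti₀ hg hy.1
    have : P.eval 1 - P.eval y ≤ L := by
      refine this.trans ?_
      have : L * g * g⁻¹ = L := by field_simp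
      have : L * g * y⁻¹ ≤ L * g * g⁻¹ := by gcongr
      have : 0 ≤ L * g := by positivity
      rw [inv_one]; linarith
    linarith [hsmall this]
  · rw [hceval]
    have := htail (Set.Icc (-1) (-g)) (convex_Icc _ _)
      (fun t ht => by
        rw [abs_of_nonpos (by linarith [ht.2])]
        exact ⟨by linarith [ht.2], by linarith [ht.1]⟩)
      (Set.left_mem_Icc.2 (by linarith)) hy hy.1
    have hy0 : 0 < -y := by linarith [hy.2]
    have hinv : (-y)⁻¹ ≤ g⁻¹ := inv_anti₀ hg (by linarith [hy.2])
    rw [inv_neg] at hinv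
    have : P.eval y - P.eval (-1) ≤ L := by
      refine this.trans ?_
      have : L * g * g⁻¹ = L := by field_simp
      have : L * g * -y⁻¹ ≤ L * g * g⁻¹ := by gcongr
      have : 0 ≤ L * g := by positivity
      rw [inv_neg, inv_one]; linarith
    linarith [hsmall this]

/-! ### A polynomial path of unit vectors -/

open Polynomial in
/-- A polynomial path of vectors `(c, f, g)`, almost of unit length, whose first coordinate
changes sign at `σ`. The vector is `(c, f, √(1 - x²) h)` with `1 - c² = f² + (1 - x²) h²` given by
Lukács' theorem, and with `√(1 - x²)` replaced by a polynomial. -/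
lemma exists_axis_path {φ η σ : ℝ} (hφ : 0 < φ) (hφ1 : φ < 1) (hη : 0 < η) (hη1 : η < 1)
    (hσ : |σ| ≤ 3 / 4) {n : ℕ} (hn : 1 ≤ n) (hnη : 14 * (1 / 4 : ℝ) ^ n ≤ η / 2) :
    ∃ (c f g : ℝ[X]) (d : ℕ), (d : ℝ) ≤ 644 * n / φ ∧
      c.natDegree ≤ d ∧ f.natDegree ≤ d ∧ g.natDegree ≤ d ∧
      (∀ x ∈ Set.Icc (-1 : ℝ) 1, c.eval x ^ 2 + f.eval x ^ 2 + g.eval x ^ 2 ≤ 1) ∧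
      (∀ x ∈ Set.Icc (-(1 / 2) : ℝ) (1 / 2),
        1 - 2 * η ≤ c.eval x ^ 2 + f.eval x ^ 2 + g.eval x ^ 2) ∧
      (∀ x ∈ Set.Icc (-1 : ℝ) 1, σ + φ / 4 ≤ x → 1 - η ≤ c.eval x) ∧
      ∀ x ∈ Set.Icc (-1 : ℝ) 1, x ≤ σ - φ / 4 → c.eval x ≤ -1 + η := by
  obtain ⟨c₀, hc₀d, hc₀, hc₀r, hc₀l⟩ := exists_sign_approx (g := φ / 8) (by linarith)
    (by linarith) hn
  obtain ⟨s, hsd, hs1, hs2⟩ := exists_sqrt_one_sub_sq_approx n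
  have hσ' := abs_le.1 hσ
  set ℓ : ℝ[X] := C (1 / 2) * (X - C σ) with hℓ
  -- The factor `1 - η / 2` makes `1 - c²` strictly positive.
  set c : ℝ[X] := C (1 - η / 2) * c₀.comp ℓ with hc
  have hceval (x : ℝ) : c.eval x = (1 - η / 2) * c₀.eval (1 / 2 * (x - σ)) := by
    simp [hc, hℓ]
  have hyI {x : ℝ} (hx : x ∈ Set.Icc (-1 : ℝ) 1) :
      1 / 2 * (x - σ) ∈ Set.Icc (-1 : ℝ) 1 := by
    constructor <;> linarith [hx.1, hx.2]
  have hcabs (x : ℝ) (hx : x ∈ Set.Icc (-1 : ℝ) 1) : |c.eval x| ≤ 1 - η / 2 := by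
    rw [hceval, abs_mul, abs_of_pos (by linarith)]
    have := hc₀ _ (hyI hx)
    nlinarith
  have hcd : c.natDegree ≤ c₀.natDegree := by
    refine (natDegree_C_mul_le _ _).trans (natDegree_comp_le.trans ?_)
    have : ℓ.natDegree ≤ 1 := (natDegree_C_mul_le _ _).trans (by simp)
    nlinarith
  clear_value c
  have hN (x : ℝ) (hx : x ∈ Set.Icc (-1 : ℝ) 1) : 0 < (1 - c ^ 2).eval x := by
    have h1 := abs_le.1 (hcabs x hx)
    simp only [eval_sub, eval_one, eval_pow]
    nlinarith [h1.1, h1.2]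
  obtain ⟨f, h, hNe, hfd, hhd⟩ := exists_sq_add_one_sub_sq_mul_sq _ hN
  have hNd : (1 - c ^ 2).natDegree ≤ 2 * c.natDegree :=
    (natDegree_sub_le _ _).trans (max_le (by simp) natDegree_pow_le)
  have hNx (x : ℝ) : 1 - c.eval x ^ 2 = f.eval x ^ 2 + (1 - x ^ 2) * h.eval x ^ 2 := by
    simpa using congrArg (eval x) hNe
  refine ⟨c, f, s * h, 4 * c₀.natDegree + 2 * n + 2, ?_, by omega, by omega,
    natDegree_mul_le.trans (by omega), fun x hx => ?_, fun x hx => ?_, fun x hx hxσ => ?_,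
    fun x hx hxσ => ?_⟩
  · have hnR : (1 : ℝ) ≤ n := by exact_mod_cast hn
    rw [le_div_iff₀ (by linarith)] at hc₀d
    rw [le_div_iff₀ hφ]
    push_cast
    nlinarith
  · have h1 := hs1 x hx
    have h2 := hNx x
    rw [eval_mul, mul_pow]
    nlinarith [mul_le_mul_of_nonneg_right h1 (sq_nonneg (h.eval x))]
  · have h1 := hs2 x hx
    have h2 := hNx x
    have hx2 : x ^ 2 ≤ 1 / 4 := by nlinarith [hx.1, hx.2]
    have h3 : h.eval x ^ 2 ≤ 4 / 3 := by
      nlinarith [sq_nonneg (c.eval x), sq_nonneg (f.eval x), sq_nonneg (h.eval x)]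
    have h4 : (0 : ℝ) < (1 / 4) ^ n := by positivity
    rw [eval_mul, mul_pow]
    have h5 := mul_le_mul_of_nonneg_right h1 (sq_nonneg (h.eval x))
    have h6 : (1 / 4) ^ n * h.eval x ^ 2 ≤ η / 28 * (4 / 3) :=
      mul_le_mul (by linarith) h3 (sq_nonneg _) (by linarith)
    nlinarith
  · have := hc₀r _ ⟨by linarith, (hyI hx).2⟩
    rw [hceval]
    nlinarith
  · have := hc₀l _ ⟨(hyI hx).1, by linarith⟩
    rw [hceval]
    nlinarith

open Polynomial in
/-- A polynomial path of unit vectors `(p₀, p₁, p₂, p₃, f, √(1 - x²) h)`, whose last two coordinates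
are small on `[-1/2, 1/2]`, and whose first four pass from `-e₁` over `e₀` to `e₁`. These four
are the coordinates of the quaternion `(1 + γ₊) (1 + γ₋) / 2`, where `γ±` are paths of imaginary
quaternions from `-i` to `i` that cross over at `±3φ/4`. The quaternion is shrunk by the factor
`1 - η`, to leave positive length for the last two coordinates. -/
theorem exists_quaternion_path {φ η : ℝ} (hφ : 0 < φ) (hφ1 : φ < 1) (hη : 0 < η) (hη1 : η < 1)
    {n : ℕ} (hn : 1 ≤ n) (hnη : 14 * (1 / 4 : ℝ) ^ n ≤ η / 2) :
    ∃ (p₀ p₁ p₂ p₃ f h : ℝ[X]) (d : ℕ), (d : ℝ) ≤ 8 * (644 * n / φ) ∧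
      p₀.natDegree ≤ d ∧ p₁.natDegree ≤ d ∧ p₂.natDegree ≤ d ∧ p₃.natDegree ≤ d ∧
      f.natDegree ≤ d ∧ h.natDegree ≤ d ∧
      p₀ ^ 2 + p₁ ^ 2 + p₂ ^ 2 + p₃ ^ 2 + (f ^ 2 + (1 - X ^ 2) * h ^ 2) = 1 ∧
      (∀ x ∈ Set.Icc (-(1 / 2) : ℝ) (1 / 2),
        1 - 4 * η ≤ p₀.eval x ^ 2 + p₁.eval x ^ 2 + p₂.eval x ^ 2 + p₃.eval x ^ 2) ∧
      (∀ x ∈ Set.Icc (-1 : ℝ) 1, φ ≤ x → 1 - 3 * η ≤ p₁.eval x) ∧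
      (∀ x ∈ Set.Icc (-1 : ℝ) 1, -(φ / 2) ≤ x → x ≤ φ / 2 → 1 - 3 * η ≤ p₀.eval x) ∧
      ∀ x ∈ Set.Icc (-1 : ℝ) 1, x ≤ -φ → p₁.eval x ≤ -(1 - 3 * η) := by
  have habs : |3 * φ / 4| ≤ 3 / 4 := by rw [abs_of_pos (by linarith)]; linarith
  obtain ⟨c, f, g, d, hd, hcd, hfd, hgd, h1, h2, h3, h4⟩ :=
    exists_axis_path hφ hφ1 hη hη1 habs hn hnη
  obtain ⟨c', f', g', d', hd', hcd', hfd', hgd', h1', h2', h3', h4'⟩ :=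
    exists_axis_path hφ hφ1 hη hη1 (by rwa [abs_neg] : |-(3 * φ / 4)| ≤ 3 / 4) hn hnη
  obtain ⟨κ, hκ⟩ : ∃ κ : ℝ, κ = (1 - η) / 2 := ⟨_, rfl⟩
  obtain ⟨D, hD, hD'⟩ : ∃ D : ℕ, D = d + d' ∧ (D : ℝ) ≤ 2 * (644 * n / φ) :=
    ⟨_, rfl, by push_cast; linarith⟩
  have hmul {p q : ℝ[X]} (hp : p.natDegree ≤ d) (hq : q.natDegree ≤ d') :
      (p * q).natDegree ≤ D := natDegree_mul_le.trans (by omega)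
  have hadd {p q : ℝ[X]} (hp : p.natDegree ≤ D) (hq : q.natDegree ≤ D) :
      (p + q).natDegree ≤ D := (natDegree_add_le _ _).trans (max_le hp hq)
  have hsub {p q : ℝ[X]} (hp : p.natDegree ≤ D) (hq : q.natDegree ≤ D) :
      (p - q).natDegree ≤ D := (natDegree_sub_le _ _).trans (max_le hp hq)
  have hC {p : ℝ[X]} (hp : p.natDegree ≤ D) : (C κ * p).natDegree ≤ D :=
    (natDegree_C_mul_le _ _).trans hp
  set p₀ := C κ * (1 - c * c' - f * f' - g * g') with hp₀
  set p₁ := C κ * (c + c' + (f * g' - g * f')) with hp₁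
  set p₂ := C κ * (f + f' + (g * c' - c * g')) with hp₂
  set p₃ := C κ * (g + g' + (c * f' - f * c')) with hp₃
  have hd₀ : p₀.natDegree ≤ D := hC (hsub (hsub (hsub (by simp) (hmul hcd hcd')) (hmul hfd hfd'))
    (hmul hgd hgd'))
  have hd₁ : p₁.natDegree ≤ D := hC (hadd (hadd (by omega) (by omega))
    (hsub (hmul hfd hgd') (hmul hgd hfd')))
  have hd₂ : p₂.natDegree ≤ D := hC (hadd (hadd (by omega) (by omega))
    (hsub (hmul hgd hcd') (hmul hcd hgd')))
  have hd₃ : p₃.natDegree ≤ D := hC (hadd (hadd (by omega) (by omega))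
    (hsub (hmul hcd hfd') (hmul hfd hcd')))
  have he₀ (x : ℝ) : p₀.eval x = κ * (1 - c.eval x * c'.eval x - f.eval x * f'.eval x -
      g.eval x * g'.eval x) := by simp [hp₀]
  have he₁ (x : ℝ) : p₁.eval x = κ * (c.eval x + c'.eval x + (f.eval x * g'.eval x -
      g.eval x * f'.eval x)) := by simp [hp₁]
  have he₂ (x : ℝ) : p₂.eval x = κ * (f.eval x + f'.eval x + (g.eval x * c'.eval x -
      c.eval x * g'.eval x)) := by simp [hp₂]
  have he₃ (x : ℝ) : p₃.eval x = κ * (g.eval x + g'.eval x + (c.eval x * f'.eval x -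
      f.eval x * c'.eval x)) := by simp [hp₃]
  clear_value p₀ p₁ p₂ p₃
  have hnorm (x : ℝ) : p₀.eval x ^ 2 + p₁.eval x ^ 2 + p₂.eval x ^ 2 + p₃.eval x ^ 2 =
      κ ^ 2 * ((1 + (c.eval x ^ 2 + f.eval x ^ 2 + g.eval x ^ 2)) *
        (1 + (c'.eval x ^ 2 + f'.eval x ^ 2 + g'.eval x ^ 2))) := by
    rw [he₀, he₁, he₂, he₃]
    ring
  have hpos (x : ℝ) (hx : x ∈ Set.Icc (-1 : ℝ) 1) :
      0 < (1 - (p₀ ^ 2 + p₁ ^ 2 + p₂ ^ 2 + p₃ ^ 2)).eval x := by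
    have e := hnorm x
    simp only [eval_sub, eval_one, eval_add, eval_pow]
    rw [e]
    have : (1 + (c.eval x ^ 2 + f.eval x ^ 2 + g.eval x ^ 2)) *
        (1 + (c'.eval x ^ 2 + f'.eval x ^ 2 + g'.eval x ^ 2)) ≤ 2 * 2 := by
      apply mul_le_mul (by linarith [h1 x hx]) (by linarith [h1' x hx]) (by positivity)
        (by norm_num)
    nlinarith [sq_nonneg κ]
  obtain ⟨F, H, hFH, hFd, hHd⟩ := exists_sq_add_one_sub_sq_mul_sq _ hpos
  have hNd : (1 - (p₀ ^ 2 + p₁ ^ 2 + p₂ ^ 2 + p₃ ^ 2)).natDegree ≤ 2 * D := by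
    have hsq {p : ℝ[X]} (hp : p.natDegree ≤ D) : (p ^ 2).natDegree ≤ 2 * D :=
      natDegree_pow_le.trans (by omega)
    refine (natDegree_sub_le _ _).trans (max_le (by simp) ?_)
    refine (natDegree_add_le _ _).trans (max_le ?_ (hsq hd₃))
    refine (natDegree_add_le _ _).trans (max_le ?_ (hsq hd₂))
    exact (natDegree_add_le _ _).trans (max_le (hsq hd₀) (hsq hd₁))
  have hperp {a u v : ℝ} (ha : 1 - η ≤ a) (hu : a ^ 2 + u ^ 2 + v ^ 2 ≤ 1) :
      u ^ 2 + v ^ 2 ≤ 2 * η := by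
    nlinarith [mul_le_mul ha ha (by linarith) (by linarith), sq_nonneg η]
  have hfin {t : ℝ} (ht : t ≥ 2 - 4 * η) : 1 - 3 * η ≤ (1 - η) / 2 * t := by
    nlinarith [mul_le_mul_of_nonneg_left ht (by linarith : 0 ≤ (1 - η) / 2), sq_nonneg η]
  refine ⟨p₀, p₁, p₂, p₃, F, H, 4 * D, ?_, by omega, by omega, by omega, by omega, by omega,
    by omega, ?_, fun x hx => ?_, fun x hx hxφ => ?_, fun x hx hxφ hxφ' => ?_, fun x hx hxφ => ?_⟩
  · have : (0 : ℝ) ≤ 644 * n / φ := by positivity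
    push_cast; linarith
  · linear_combination -hFH
  · rw [hnorm]
    have := mul_le_mul (by linarith [h2 x hx] :
      2 - 2 * η ≤ 1 + (c.eval x ^ 2 + f.eval x ^ 2 + g.eval x ^ 2))
      (by linarith [h2' x hx] :
      2 - 2 * η ≤ 1 + (c'.eval x ^ 2 + f'.eval x ^ 2 + g'.eval x ^ 2)) (by linarith) (by positivity)
    have h5 := mul_le_mul_of_nonneg_left this (sq_nonneg κ)
    refine le_trans ?_ h5
    have e : κ ^ 2 * ((2 - 2 * η) * (2 - 2 * η)) = ((1 - η) ^ 2) ^ 2 := by rw [hκ]; ring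
    rw [e]
    nlinarith [sq_nonneg ((1 - η) ^ 2 - 1), sq_nonneg η]
  · have ha := h3 x hx (by linarith)
    have hb := h3' x hx (by linarith)
    have hfg := hperp ha (h1 x hx)
    have hfg' := hperp hb (h1' x hx)
    have hx1 : c.eval x + c'.eval x + (f.eval x * g'.eval x - g.eval x * f'.eval x) ≥
        2 - 4 * η := by
      linarith [sq_nonneg (f.eval x + g'.eval x), sq_nonneg (g.eval x - f'.eval x)]
    rw [he₁, hκ]
    exact hfin hx1
  · have ha := h4 x hx (by linarith)
    have hb := h3' x hx (by linarith)
    have hfg := hperp (a := -c.eval x) (u := f.eval x) (v := g.eval x) (by linarith)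
      (by rw [neg_sq]; exact h1 x hx)
    have hfg' := hperp hb (h1' x hx)
    have hx2 : (1 - η) * (1 - η) ≤ -c.eval x * c'.eval x :=
      mul_le_mul (by linarith) hb (by linarith) (by linarith)
    have hx1 : 1 - c.eval x * c'.eval x - f.eval x * f'.eval x - g.eval x * g'.eval x ≥
        2 - 4 * η := by
      linarith [sq_nonneg (f.eval x - f'.eval x), sq_nonneg (g.eval x - g'.eval x), sq_nonneg η]
    rw [he₀, hκ]
    exact hfin hx1
  · have ha := h4 x hx (by linarith)
    have hb := h4' x hx (by linarith)
    have hfg := hperp (a := -c.eval x) (u := f.eval x) (v := g.eval x) (by linarith)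
      (by rw [neg_sq]; exact h1 x hx)
    have hfg' := hperp (a := -c'.eval x) (u := f'.eval x) (v := g'.eval x) (by linarith)
      (by rw [neg_sq]; exact h1' x hx)
    have hx1 : -(c.eval x + c'.eval x + (f.eval x * g'.eval x - g.eval x * f'.eval x)) ≥
        2 - 4 * η := by
      linarith [sq_nonneg (f.eval x - g'.eval x), sq_nonneg (g.eval x + f'.eval x)]
    rw [he₁, hκ]
    linarith [hfin hx1]

/-! ### Circuits acting on the subspace with control qubit `|0⟩` -/

open Matrix in
/-- `B` on the first factor, controlled on the range of the projection `Q` of the second. -/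
noncomputable def layer {K J : Type} [DecidableEq K] [DecidableEq J]
    (B : Matrix K K ℂ) (Q : Matrix J J ℂ) : Matrix (K × J) (K × J) ℂ :=
  B ⊗ₖ Q + 1 ⊗ₖ (1 - Q)

lemma layer_mul {K J : Type} [Fintype K] [Fintype J] [DecidableEq K] [DecidableEq J]
    (B B' : Matrix K K ℂ) {Q : Matrix J J ℂ} (hQ : Q * Q = Q) :
    layer B Q * layer B' Q = layer (B * B') Q := by
  have h1 : Q * (1 - Q) = 0 := by rw [mul_sub, hQ, mul_one, sub_self]
  have h2 : (1 - Q) * Q = 0 := by rw [sub_mul, hQ, one_mul, sub_self]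
  have h3 : (1 - Q) * (1 - Q) = 1 - Q := by rw [mul_sub, mul_one, h2, sub_zero]
  simp [layer, add_mul, mul_add, ← Matrix.mul_kronecker_mul, hQ, h1, h2, h3]

lemma layer_one {K J : Type} [DecidableEq K] [DecidableEq J] (Q : Matrix J J ℂ) :
    layer (1 : Matrix K K ℂ) Q = 1 := by
  rw [layer, ← Matrix.kronecker_add, add_sub_cancel, Matrix.one_kronecker_one]

lemma layer_mem_unitaryGroup {K J : Type} [Fintype K] [Fintype J] [DecidableEq K] [DecidableEq J]
    {B : Matrix K K ℂ} (hB : B ∈ Matrix.unitaryGroup K ℂ) {Q : Matrix J J ℂ} (hQ : Q * Q = Q)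
    (hQ' : Q.IsHermitian) : layer B Q ∈ Matrix.unitaryGroup (K × J) ℂ := by
  have h : star (layer B Q) = layer (star B) Q := by
    simp [layer, Matrix.star_eq_conjTranspose, Matrix.conjTranspose_kronecker, hQ'.eq]
  rw [Matrix.mem_unitaryGroup_iff, h, layer_mul _ _ hQ, Matrix.mem_unitaryGroup_iff.1 hB, layer_one]

lemma submatrix_mem_unitaryGroup {m n : Type} [Fintype m] [Fintype n] [DecidableEq m]
    [DecidableEq n] {M : Matrix m m ℂ} (hM : M ∈ Matrix.unitaryGroup m ℂ) (e : n ≃ m) :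
    M.submatrix e e ∈ Matrix.unitaryGroup n ℂ := by
  rw [Matrix.mem_unitaryGroup_iff, Matrix.star_eq_conjTranspose, Matrix.conjTranspose_submatrix,
    Matrix.submatrix_mul_equiv, ← Matrix.star_eq_conjTranspose, Matrix.mem_unitaryGroup_iff.1 hM,
    Matrix.submatrix_one_equiv]

section

set_option linter.unusedSectionVars false

variable {D R J : Type} [Fintype D] [DecidableEq D] [Fintype R] [DecidableEq R] [Fintype J]
  [DecidableEq J]

/-- Given a splitting `e` of the workspace into a qubit and a rest `J`, the bijection of labels that
moves this qubit next to the oracle register. -/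
def splitEquiv (D : Type) {R J : Type} (e : R ≃ Fin 2 × J) : D × R ≃ (D × Fin 2) × J :=
  ((Equiv.refl D).prodCongr e).trans (Equiv.prodAssoc D (Fin 2) J).symm

/-- The vector `|0⟩ ⊗ Ψ 0 + |1⟩ ⊗ Ψ 1`, the first factor being the control qubit. -/
def embed (e : R ≃ Fin 2 × J) (Ψ : Fin 2 → (D × Fin 2) × J → ℂ) : Fin 2 × (D × R) → ℂ :=
  fun x => Ψ x.1 (splitEquiv D e x.2)

open Matrix in
lemma kronecker_mulVec_embed (e : R ≃ Fin 2 × J) (A : Matrix (Fin 2) (Fin 2) ℂ)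
    (M : Matrix ((D × Fin 2) × J) ((D × Fin 2) × J) ℂ) (Ψ : Fin 2 → (D × Fin 2) × J → ℂ) :
    (A ⊗ₖ M.submatrix (splitEquiv D e) (splitEquiv D e)) *ᵥ embed e Ψ =
      embed e fun i => ∑ j, A i j • (M *ᵥ Ψ j) := by
  ext ⟨i, x⟩
  simp only [Matrix.mulVec, dotProduct, embed, Fintype.sum_prod_type (α₁ := Fin 2),
    kroneckerMap_apply, submatrix_apply, Finset.sum_apply, Pi.smul_apply, smul_eq_mul,
    Finset.mul_sum]
  refine Finset.sum_congr rfl fun j _ => ?_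
  rw [← (splitEquiv D e).sum_comp]
  exact Finset.sum_congr rfl fun y _ => by ring

open Matrix in
lemma controlled_mulVec_embed (e : R ≃ Fin 2 × J) (M : Matrix D D ℂ)
    (Ψ : Fin 2 → (D × Fin 2) × J → ℂ) :
    controlled R M *ᵥ embed e Ψ =
      embed e ![Ψ 0, ((M ⊗ₖ (1 : Matrix (Fin 2) (Fin 2) ℂ)) ⊗ₖ (1 : Matrix J J ℂ)) *ᵥ Ψ 1] := by
  have h1 : (1 : Matrix (D × R) (D × R) ℂ) = (1 : Matrix ((D × Fin 2) × J) _ ℂ).submatrix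
      (splitEquiv D e) (splitEquiv D e) := (submatrix_one_equiv _).symm
  have h2 : M ⊗ₖ (1 : Matrix R R ℂ) =
      ((M ⊗ₖ (1 : Matrix (Fin 2) (Fin 2) ℂ)) ⊗ₖ (1 : Matrix J J ℂ)).submatrix
        (splitEquiv D e) (splitEquiv D e) := by
    ext ⟨d, r⟩ ⟨d', r'⟩
    have : (1 : Matrix R R ℂ) r r' = (1 : Matrix (Fin 2) (Fin 2) ℂ) (e r).1 (e r').1 *
        (1 : Matrix J J ℂ) (e r).2 (e r').2 := by
      rw [← kroneckerMap_apply (fun a b => a * b), one_kronecker_one, one_apply, one_apply]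
      simp
    simp [splitEquiv, this, mul_assoc]
  rw [controlled, h1, h2, add_mulVec, kronecker_mulVec_embed, kronecker_mulVec_embed]
  ext ⟨i, x⟩
  fin_cases i <;> simp [embed, Matrix.single_apply]

/-- On the subspace where the control qubit is `|0⟩`, the circuit `c` with oracle `U` acts as `M U`;
in particular it leaves this subspace invariant. -/
def Implements (e : R ≃ Fin 2 × J) (c : QueryCircuit D R)
    (M : Matrix.unitaryGroup D ℂ → Matrix ((D × Fin 2) × J) ((D × Fin 2) × J) ℂ) : Prop :=
  ∀ U Ψ, (c.toMatrix U).mulVec (embed e ![Ψ, 0]) = embed e ![(M U).mulVec Ψ, 0]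

lemma Implements.seq {e : R ≃ Fin 2 × J} {c₁ c₂ : QueryCircuit D R} {M₁ M₂}
    (h₁ : Implements e c₁ M₁) (h₂ : Implements e c₂ M₂) :
    Implements e (c₁.seq c₂) fun U => M₂ U * M₁ U := fun U Ψ => by
  rw [QueryCircuit.toMatrix, ← Matrix.mulVec_mulVec, h₁, h₂, Matrix.mulVec_mulVec]

lemma exists_implements_unitary (e : R ≃ Fin 2 × J)
    {V : Matrix ((D × Fin 2) × J) ((D × Fin 2) × J) ℂ}
    (hV : V ∈ Matrix.unitaryGroup ((D × Fin 2) × J) ℂ) :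
    ∃ c : QueryCircuit D R, c.numQueries = 0 ∧ Implements e c fun _ => V := by
  refine ⟨.gate ⟨(1 : Matrix (Fin 2) (Fin 2) ℂ) ⊗ₖ V.submatrix (splitEquiv D e) (splitEquiv D e),
    Matrix.kronecker_mem_unitary (one_mem _) (submatrix_mem_unitaryGroup hV _)⟩, rfl,
    fun U Ψ => ?_⟩
  rw [QueryCircuit.toMatrix, kronecker_mulVec_embed]
  congr 1
  ext i x
  fin_cases i <;> simp [Matrix.one_apply]

open Matrix in
/-- A single use of the oracle, controlled on the range of a projection of the workspace: the
control qubit is flipped on this range before and after the query. -/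
lemma exists_implements_query (e : R ≃ Fin 2 × J) {E : Matrix (Fin 2) (Fin 2) ℂ}
    {Q : Matrix J J ℂ} (hE : E * E = E) (hE' : E.IsHermitian) (hQ : Q * Q = Q)
    (hQ' : Q.IsHermitian) (q : QueryCircuit D R) (f : unitaryGroup D ℂ → Matrix D D ℂ)
    (hq : ∀ U, q.toMatrix U = controlled R (f U)) :
    ∃ c : QueryCircuit D R, c.numQueries = q.numQueries ∧
      Implements e c fun U => layer (f U ⊗ₖ E + 1 ⊗ₖ (1 - E)) Q := by
  set P : Matrix ((D × Fin 2) × J) ((D × Fin 2) × J) ℂ := ((1 : Matrix D D ℂ) ⊗ₖ E) ⊗ₖ Q with hP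
  have hPP : P * P = P := by rw [hP, ← mul_kronecker_mul, ← mul_kronecker_mul, hE, hQ, one_mul]
  have hPh : P.IsHermitian := by
    rw [Matrix.IsHermitian, hP, conjTranspose_kronecker, conjTranspose_kronecker, hE'.eq, hQ'.eq,
      conjTranspose_one]
  have hP1 : P * (1 - P) = 0 := by rw [mul_sub, hPP, mul_one, sub_self]
  have hP2 : (1 - P) * P = 0 := by rw [sub_mul, hPP, one_mul, sub_self]
  have hP3 : (1 - P) * (1 - P) = 1 - P := by rw [mul_sub, mul_one, hP2, sub_zero]
  set σ := splitEquiv D e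
  let Xg : Matrix (Fin 2) (Fin 2) ℂ := !![0, 1; 1, 0]
  have hX : Xg * Xg = 1 := by ext i j; fin_cases i <;> fin_cases j <;> simp [Xg]
  have hXh : Xgᴴ = Xg := by ext i j; fin_cases i <;> fin_cases j <;> simp [Xg]
  set F : Matrix (Fin 2 × (D × R)) (Fin 2 × (D × R)) ℂ :=
    Xg ⊗ₖ P.submatrix σ σ + 1 ⊗ₖ (1 - P).submatrix σ σ with hF
  have hFu : F ∈ unitaryGroup (Fin 2 × (D × R)) ℂ := by
    have hFh : star F = F := by
      rw [hF, star_eq_conjTranspose, conjTranspose_add, conjTranspose_kronecker,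
        conjTranspose_kronecker, conjTranspose_submatrix, conjTranspose_submatrix, hXh, hPh.eq,
        conjTranspose_sub, hPh.eq, conjTranspose_one, conjTranspose_one]
    rw [mem_unitaryGroup_iff, hFh, hF]
    simp only [add_mul, mul_add, ← mul_kronecker_mul, submatrix_mul_equiv, hPP, hP1, hP2, hP3, hX,
      one_mul, mul_one, submatrix_zero, Pi.zero_apply, kronecker_zero, add_zero, zero_add]
    rw [← kronecker_add, ← Pi.add_apply, ← Pi.add_apply, ← submatrix_add, add_sub_cancel,
      submatrix_one_equiv, one_kronecker_one]
  have hFemb (Ψ : Fin 2 → (D × Fin 2) × J → ℂ) : F *ᵥ embed e Ψ =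
      embed e ![P *ᵥ Ψ 1 + (1 - P) *ᵥ Ψ 0, P *ᵥ Ψ 0 + (1 - P) *ᵥ Ψ 1] := by
    rw [hF, add_mulVec, kronecker_mulVec_embed, kronecker_mulVec_embed]
    ext ⟨i, x⟩
    fin_cases i <;> simp [embed, Xg]
  refine ⟨((QueryCircuit.gate ⟨F, hFu⟩).seq q).seq (.gate ⟨F, hFu⟩), by
    simp [QueryCircuit.numQueries], fun U Ψ => ?_⟩
  simp only [QueryCircuit.toMatrix, hq]
  rw [← mulVec_mulVec, ← mulVec_mulVec, hFemb, controlled_mulVec_embed, hFemb]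
  set V := (f U ⊗ₖ (1 : Matrix (Fin 2) (Fin 2) ℂ)) ⊗ₖ (1 : Matrix J J ℂ) with hV
  have hVP : V * P = (f U ⊗ₖ E) ⊗ₖ Q := by
    rw [hV, hP, ← mul_kronecker_mul, ← mul_kronecker_mul, mul_one, one_mul, one_mul]
  have hPV : P * V = (f U ⊗ₖ E) ⊗ₖ Q := by
    rw [hV, hP, ← mul_kronecker_mul, ← mul_kronecker_mul, mul_one, one_mul, mul_one]
  have hres : layer (f U ⊗ₖ E + 1 ⊗ₖ (1 - E)) Q = P * V + (1 - P) := by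
    have h1 : P + (((1 : Matrix D D ℂ) ⊗ₖ (1 - E)) ⊗ₖ Q + 1 ⊗ₖ (1 - Q)) = 1 := by
      rw [hP, ← add_assoc, ← add_kronecker, ← kronecker_add, add_sub_cancel, one_kronecker_one,
        ← kronecker_add, add_sub_cancel, one_kronecker_one]
    rw [hPV, layer, add_kronecker, ← h1]
    abel
  have hz : (1 - P) * V * P = 0 := by
    rw [mul_assoc, hVP, ← hPV, ← mul_assoc, hP2, zero_mul]
  have hp : P * V * P = P * V := by rw [mul_assoc, hVP, ← hPV, ← mul_assoc, hPP]
  rw [hres]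
  congr 1
  ext i : 1
  fin_cases i
  · simp [mulVec_mulVec, hp, hP3, add_mulVec, ← mul_assoc]
  · simp [mulVec_mulVec, hz, hP1, ← mul_assoc]

end

/-! ### Quantum signal processing with vector-valued polynomials -/

section

set_option linter.unusedSectionVars false

variable {J : Type} [Fintype J] [DecidableEq J]

lemma star_dotProduct_self_eq_sum (x : J → ℂ) : star x ⬝ᵥ x = ((∑ j, ‖x j‖ ^ 2 : ℝ) : ℂ) := by
  simp only [dotProduct, Pi.star_apply, RCLike.star_def, Complex.conj_mul']
  push_cast
  rfl

lemma exists_unitary_column {u : J → ℂ} (hu : ∑ j, ‖u j‖ ^ 2 = 1) (j₀ : J) :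
    ∃ V ∈ Matrix.unitaryGroup J ℂ, ∀ j, V j j₀ = u j := by
  have hn : ‖(WithLp.toLp 2 u : EuclideanSpace ℂ J)‖ = 1 := by
    rw [EuclideanSpace.norm_eq, Real.sqrt_eq_one]; exact hu
  obtain ⟨b, hb⟩ := Orthonormal.exists_orthonormalBasis_extension_of_card_eq (𝕜 := ℂ)
    (E := EuclideanSpace ℂ J) (ι := J) (by simp) (v := fun _ => WithLp.toLp 2 u) (s := {j₀})
    ⟨fun _ => hn, fun i j hij => (hij (Subsingleton.elim i j)).elim⟩
  refine ⟨(EuclideanSpace.basisFun J ℂ).toBasis.toMatrix b,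
    OrthonormalBasis.toMatrix_orthonormalBasis_mem_unitary _ _, fun j => ?_⟩
  rw [Module.Basis.toMatrix_apply, hb j₀ rfl]
  simp

open Polynomial in
/-- On the circle, conjugation of `p` amounts to the reversal of its conjugated coefficients. -/
lemma eval_reflect_map_conj {p : ℂ[X]} {N : ℕ} (hp : p.natDegree ≤ N) {z : ℂ} (hz : ‖z‖ = 1) :
    (reflect N (p.map (starRingEnd ℂ))).eval z = z ^ N * starRingEnd ℂ (p.eval z) := by
  have hz0 : z ≠ 0 := by rintro rfl; simp at hz
  have hzc : starRingEnd ℂ z = z⁻¹ := by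
    rw [Complex.inv_def, Complex.normSq_eq_norm_sq, hz]; simp
  let : Invertible z⁻¹ := invertibleOfNonzero (inv_ne_zero hz0)
  have h := eval₂_reflect_mul_pow (RingHom.id ℂ) z⁻¹ N (p.map (starRingEnd ℂ))
    (natDegree_map_le.trans hp)
  rw [invOf_eq_inv, inv_inv, ← eval, ← eval] at h
  have h2 : (p.map (starRingEnd ℂ)).eval z⁻¹ = starRingEnd ℂ (p.eval z) := by
    rw [← hzc, eval_map, eval₂_at_apply]
  rw [← h2, ← h, inv_pow]
  field_simp

lemma infinite_unit_circle : {z : ℂ | ‖z‖ = 1}.Infinite := by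
  have : {z : ℂ | ‖z‖ = 1} = Metric.sphere 0 1 := by ext; simp
  rw [this]
  refine (isPreconnected_sphere (by simp [Complex.rank_real_complex]) 0 1).infinite_of_nontrivial
    ⟨1, by simp, -1, by simp, ?_⟩
  norm_num

open Polynomial in
/-- For a vector-valued polynomial of unit length on the circle, the constant and the top
coefficients are orthogonal. -/
lemma sum_conj_coeff_mul_coeff_zero {N : ℕ} (hN : N ≠ 0) {v : J → ℂ[X]}
    (hv : ∀ j, (v j).natDegree ≤ N) (hu : ∀ z : ℂ, ‖z‖ = 1 → ∑ j, ‖(v j).eval z‖ ^ 2 = 1) :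
    ∑ j, starRingEnd ℂ ((v j).coeff N) * (v j).coeff 0 = 0 := by
  have h : ∑ j, reflect N ((v j).map (starRingEnd ℂ)) * v j = X ^ N := by
    refine eq_of_infinite_eval_eq _ _ (infinite_unit_circle.mono fun z hz => ?_)
    simp only [Set.mem_ofPred_eq] at hz ⊢
    have h1 := congrArg (fun t : ℝ => (t : ℂ)) (hu z hz)
    simp only [eval_finsetSum, eval_mul, eval_pow, eval_X]
    calc _ = ∑ j, z ^ N * ((‖(v j).eval z‖ ^ 2 : ℝ) : ℂ) := by
          refine Finset.sum_congr rfl fun j _ => ?_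
          rw [eval_reflect_map_conj (hv j) hz, mul_assoc, Complex.conj_mul', Complex.ofReal_pow]
      _ = z ^ N := by
          rw [← Finset.mul_sum, ← Complex.ofReal_sum, hu z hz]; simp
  have h0 := congrArg (fun p => coeff p 0) h
  simp only [finsetSum_coeff, mul_coeff_zero, coeff_X_pow, coeff_reflect, coeff_map,
    revAt_le (Nat.zero_le N), Nat.sub_zero, if_neg hN.symm] at h0
  exact h0

open Polynomial Matrix in
/-- Layer stripping: a vector-valued polynomial of positive degree and of unit length on the circle
is `(1 - Q) + z Q` applied to one of smaller degree, `Q` being the projection onto the top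
coefficient. -/
lemma exists_layer_stripping {n : ℕ} {v : J → ℂ[X]} (hv : ∀ j, (v j).natDegree ≤ n + 1)
    (hu : ∀ z : ℂ, ‖z‖ = 1 → ∑ j, ‖(v j).eval z‖ ^ 2 = 1) :
    ∃ (Q : Matrix J J ℂ) (v' : J → ℂ[X]), Q * Q = Q ∧ Q.IsHermitian ∧
      (∀ j, (v' j).natDegree ≤ n) ∧ (∀ z : ℂ, ‖z‖ = 1 → ∑ j, ‖(v' j).eval z‖ ^ 2 = 1) ∧
      v = (1 - Q.map C : Matrix J J ℂ[X]) *ᵥ v' +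
        (X : ℂ[X]) • ((Q.map C : Matrix J J ℂ[X]) *ᵥ v') := by
  set u : J → ℂ := fun j => (v j).coeff (n + 1) with hudef
  obtain ⟨Q, hQQ, hQh, hQu, hQ0⟩ : ∃ Q : Matrix J J ℂ, Q * Q = Q ∧ Q.IsHermitian ∧ Q *ᵥ u = u ∧
      Q *ᵥ (fun j => (v j).coeff 0) = 0 := by
    have horth : star u ⬝ᵥ (fun j => (v j).coeff 0) = 0 :=
      sum_conj_coeff_mul_coeff_zero n.succ_ne_zero hv hu
    by_cases hu0 : u = 0
    -- Without a top coefficient the degree is already smaller, and `Q = 0` splits off nothing.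
    · exact ⟨0, by simp, by simp, by simp [hu0], by simp⟩
    · set r : ℝ := ∑ j, ‖u j‖ ^ 2 with hr
      have hr0 : (r : ℂ) ≠ 0 := by
        rw [Complex.ofReal_ne_zero]
        refine fun h => hu0 (funext fun j => ?_)
        have := (Finset.sum_eq_zero_iff_of_nonneg fun _ _ => by positivity).1 h j
          (Finset.mem_univ j)
        simpa using this
      have huu : star u ⬝ᵥ u = r := star_dotProduct_self_eq_sum u
      refine ⟨(r : ℂ)⁻¹ • vecMulVec u (star u), ?_, ?_, ?_, ?_⟩
      · rw [smul_mul_smul_comm, vecMulVec_mul_vecMulVec, huu]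
        simp only [vecMulVec_smul, smul_smul]
        congr 1
        field_simp
      · rw [Matrix.IsHermitian, conjTranspose_smul, conjTranspose_vecMulVec]
        simp
      · rw [smul_mulVec, vecMulVec_mulVec, huu]
        ext j; simp [hr0]
      · rw [smul_mulVec, vecMulVec_mulVec, horth]
        simp
  have hQp : Q.map C * Q.map C = (Q.map C : Matrix J J ℂ[X]) := by rw [← Matrix.map_mul, hQQ]
  set Qp : Matrix J J ℂ[X] := Q.map C with hQpdef
  set w : J → ℂ[X] := fun j => (v j).divX with hw
  have hvw : v = (X : ℂ[X]) • w + fun j => C ((v j).coeff 0) := by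
    ext1 j
    simp [hw, X_mul_divX_add]
  have hQv : Qp *ᵥ v = (X : ℂ[X]) • (Qp *ᵥ w) := by
    have h0 : Qp *ᵥ (fun j => C ((v j).coeff 0)) = 0 := by
      ext1 j
      have := congrArg C (congrFun hQ0 j)
      simpa [mulVec, dotProduct, hQpdef, map_sum] using this
    conv_lhs => rw [hvw]
    rw [mulVec_add, h0, add_zero, mulVec_smul]
  have e1 : (1 - Qp) * Qp = 0 := by rw [sub_mul, hQp, one_mul, sub_self]
  have e2 : (1 - Qp) * (1 - Qp) = 1 - Qp := by rw [mul_sub, e1, mul_one, sub_zero]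
  have e3 : Qp * (1 - Qp) = 0 := by rw [mul_sub, hQp, mul_one, sub_self]
  obtain ⟨v', hv'⟩ : ∃ v' : J → ℂ[X], v' = (1 - Qp) *ᵥ v + Qp *ᵥ w := ⟨_, rfl⟩
  have hmain : v = (1 - Qp) *ᵥ v' + (X : ℂ[X]) • (Qp *ᵥ v') := by
    rw [hv']
    simp only [mulVec_add, mulVec_mulVec, e1, e2, e3, hQp, zero_mulVec, zero_add, add_zero]
    rw [← hQv, ← add_mulVec, sub_add_cancel, one_mulVec]
  refine ⟨Q, v', hQQ, hQh, fun j => ?_, fun z hz => ?_, hmain⟩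
  · have hwd (i : J) : (w i).natDegree ≤ n := by
      rw [hw, natDegree_divX_eq_natDegree_tsub_one]
      have := hv i
      omega
    have hsum (i : J) : (Qp *ᵥ w) i = ∑ k, C (Q i k) * w k := by simp [mulVec, dotProduct, hQpdef]
    have hsum' (i : J) : (Qp *ᵥ v) i = ∑ k, C (Q i k) * v k := by simp [mulVec, dotProduct, hQpdef]
    rw [hv', Pi.add_apply]
    refine (natDegree_add_le _ _).trans (max_le ?_ ?_)
    · have h1 : ((1 - Qp) *ᵥ v) j = v j - ∑ k, C (Q j k) * v k := by
        rw [sub_mulVec, one_mulVec, Pi.sub_apply, hsum']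
      rw [h1]
      have h2 : (v j - ∑ k, C (Q j k) * v k).natDegree ≤ n + 1 :=
        (natDegree_sub_le _ _).trans (max_le (hv j) (natDegree_sum_le_of_forall_le _ _
          fun k _ => (natDegree_C_mul_le _ _).trans (hv k)))
      refine natDegree_le_iff_coeff_eq_zero.2 fun N hN => ?_
      rcases Nat.lt_or_ge (n + 1) N with hN' | hN'
      · exact coeff_eq_zero_of_natDegree_lt (h2.trans_lt hN')
      · obtain rfl : N = n + 1 := by omega
        have := congrFun hQu j
        simp only [mulVec, dotProduct, hudef] at this
        simp [finsetSum_coeff, this]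
    · rw [hsum]
      exact natDegree_sum_le_of_forall_le _ _ fun k _ => (natDegree_C_mul_le _ _).trans (hwd k)
  · set x : J → ℂ := fun j => (v' j).eval z with hx
    have hz1 : star z * z = 1 := by simp [Complex.conj_mul', hz]
    set M : Matrix J J ℂ := (1 - Q) + z • Q with hM
    have hMM : Mᴴ * M = 1 := by
      have f1 : (1 - Q) * Q = 0 := by rw [sub_mul, hQQ, one_mul, sub_self]
      have f2 : Q * (1 - Q) = 0 := by rw [mul_sub, hQQ, mul_one, sub_self]
      have f3 : (1 - Q) * (1 - Q) = 1 - Q := by rw [mul_sub, f1, mul_one, sub_zero]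
      rw [hM, conjTranspose_add, conjTranspose_sub, conjTranspose_smul, hQh.eq, conjTranspose_one]
      simp [mul_add, add_mul, f1, f2, f3, hQQ, smul_smul, mul_comm z]
      simp at hz1
      simp [hz1]
    have hvx : (fun j => (v j).eval z) = M *ᵥ x := by
      ext j
      have := congrArg (eval z) (congrFun hmain j)
      rw [this, Pi.add_apply, Pi.smul_apply, eval_add, smul_eq_mul, eval_mul, eval_X, hM,
        add_mulVec, smul_mulVec, sub_mulVec, sub_mulVec, one_mulVec, one_mulVec, Pi.add_apply]
      simp [mulVec, dotProduct, hx, hQpdef, eval_finsetSum]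
    have h1 : star x ⬝ᵥ x = star (M *ᵥ x) ⬝ᵥ (M *ᵥ x) := by
      rw [star_mulVec, ← dotProduct_mulVec, mulVec_mulVec, hMM, one_mulVec]
    rw [← hvx, star_dotProduct_self_eq_sum, star_dotProduct_self_eq_sum, hu z hz] at h1
    exact_mod_cast h1

end

section

set_option linter.unusedSectionVars false

variable {D R J : Type} [Fintype D] [DecidableEq D] [Fintype R] [DecidableEq R] [Fintype J]
  [DecidableEq J]

open Matrix in
lemma kronecker_mulVec_apply {K : Type} [Fintype K] (B : Matrix K K ℂ) (M : Matrix J J ℂ)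
    (Ψ : K × J → ℂ) (k : K) (j : J) :
    ((B ⊗ₖ M) *ᵥ Ψ) (k, j) = ∑ i, M j i * (B *ᵥ fun k => Ψ (k, i)) k := by
  simp only [mulVec, dotProduct, Fintype.sum_prod_type_right, kroneckerMap_apply, Finset.mul_sum]
  exact Finset.sum_congr rfl fun _ _ => Finset.sum_congr rfl fun _ _ => by ring

open Matrix in
/-- The Hermitian dilation `|1⟩⟨0| ⊗ U + |0⟩⟨1| ⊗ U†` of a unitary, the qubit being the second
factor. It is written as the product of a query, an inverse query and a bit flip. -/
noncomputable def dilation (U : Matrix D D ℂ) : Matrix (D × Fin 2) (D × Fin 2) ℂ :=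
  ((1 : Matrix D D ℂ) ⊗ₖ !![0, 1; 1, 0]) *
    ((U ⊗ₖ !![1, 0; 0, 0] + 1 ⊗ₖ (1 - !![1, 0; 0, 0])) *
      (star U ⊗ₖ !![0, 0; 0, 1] + 1 ⊗ₖ (1 - !![0, 0; 0, 1])))

open Matrix in
lemma dilation_mulVec (U : Matrix D D ℂ) (χ : D × Fin 2 → ℂ) (d : D) (i : Fin 2) :
    (dilation U *ᵥ χ) (d, i) =
      ![(star U *ᵥ fun d => χ (d, 1)) d, (U *ᵥ fun d => χ (d, 0)) d] i := by
  rw [dilation, ← mulVec_mulVec, ← mulVec_mulVec, kronecker_mulVec_apply]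
  fin_cases i <;> simp [add_mulVec, kronecker_mulVec_apply]

lemma dilation_mul_self (U : Matrix.unitaryGroup D ℂ) :
    dilation (U : Matrix D D ℂ) * dilation (U : Matrix D D ℂ) = 1 := by
  refine Matrix.ext_of_mulVec_single fun x => ?_
  rw [← Matrix.mulVec_mulVec, Matrix.one_mulVec]
  ext ⟨d, i⟩
  have h1 := Matrix.mem_unitaryGroup_iff.1 U.2
  have h2 := Matrix.mem_unitaryGroup_iff'.1 U.2
  fin_cases i <;> simp [dilation_mulVec, h1, h2, -Matrix.mulVec_single]

lemma exists_implements_layer_dilation (e : R ≃ Fin 2 × J) {Q : Matrix J J ℂ} (hQ : Q * Q = Q)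
    (hQ' : Q.IsHermitian) :
    ∃ c : QueryCircuit D R, c.numQueries = 2 ∧
      Implements e c fun U => layer (dilation (U : Matrix D D ℂ)) Q := by
  obtain ⟨c₁, h₁, h₁'⟩ := exists_implements_query e (E := !![0, 0; 0, 1])
    (by ext i j; fin_cases i <;> fin_cases j <;> simp)
    (by ext i j; fin_cases i <;> fin_cases j <;> simp) hQ hQ' (QueryCircuit.queryInv (D := D))
    (fun U => star (U : Matrix D D ℂ)) fun U => rfl
  obtain ⟨c₂, h₂, h₂'⟩ := exists_implements_query e (E := !![1, 0; 0, 0])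
    (by ext i j; fin_cases i <;> fin_cases j <;> simp)
    (by ext i j; fin_cases i <;> fin_cases j <;> simp) hQ hQ' (QueryCircuit.query (D := D))
    (fun U => (U : Matrix D D ℂ)) fun U => rfl
  have hX : (!![0, 1; 1, 0] : Matrix (Fin 2) (Fin 2) ℂ) ∈ Matrix.unitaryGroup (Fin 2) ℂ := by
    rw [Matrix.mem_unitaryGroup_iff]
    ext i j; fin_cases i <;> fin_cases j <;> simp [Matrix.star_eq_conjTranspose, Matrix.mul_apply]
  obtain ⟨c₃, h₃, h₃'⟩ := exists_implements_unitary e (layer_mem_unitaryGroup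
    (Matrix.kronecker_mem_unitary (one_mem (Matrix.unitaryGroup D ℂ)) hX) hQ hQ')
  refine ⟨(c₁.seq c₂).seq c₃, by simp [QueryCircuit.numQueries, h₁, h₂, h₃], ?_⟩
  have := (h₁'.seq h₂').seq h₃'
  simp only [layer_mul _ _ hQ] at this
  exact this

/-- A step `S · dilation U` of the quantum walk, controlled on a projection, costs two queries. -/
lemma exists_implements_layer_walk (e : R ≃ Fin 2 × J) {S : Matrix (D × Fin 2) (D × Fin 2) ℂ}
    (hS : S ∈ Matrix.unitaryGroup (D × Fin 2) ℂ) {Q : Matrix J J ℂ} (hQ : Q * Q = Q)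
    (hQ' : Q.IsHermitian) :
    ∃ c : QueryCircuit D R, c.numQueries = 2 ∧
      Implements e c fun U => layer (S * dilation (U : Matrix D D ℂ)) Q := by
  obtain ⟨c₁, h₁, h₁'⟩ := exists_implements_layer_dilation (D := D) e hQ hQ'
  obtain ⟨c₂, h₂, h₂'⟩ := exists_implements_unitary e (layer_mem_unitaryGroup hS hQ hQ')
  refine ⟨c₁.seq c₂, by simp [QueryCircuit.numQueries, h₁, h₂], ?_⟩
  have := h₁'.seq h₂'
  simp only [layer_mul _ _ hQ] at this
  exact this

/-- Powers of the inverse `dilation U · S` of the quantum walk. -/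
lemma exists_implements_walk_inv_pow (e : R ≃ Fin 2 × J) {S : Matrix (D × Fin 2) (D × Fin 2) ℂ}
    (hS : S ∈ Matrix.unitaryGroup (D × Fin 2) ℂ) (n : ℕ) :
    ∃ c : QueryCircuit D R, c.numQueries = 2 * n ∧
      Implements e c fun U => layer ((dilation (U : Matrix D D ℂ) * S) ^ n) (1 : Matrix J J ℂ) := by
  have h1 : (1 : Matrix J J ℂ) * 1 = 1 := one_mul 1
  induction n with
  | zero =>
    obtain ⟨c, h, h'⟩ := exists_implements_unitary (D := D) e (one_mem (Matrix.unitaryGroup _ ℂ))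
    exact ⟨c, h, by simpa only [pow_zero, layer_one] using h'⟩
  | succ n ih =>
    obtain ⟨c₀, h₀, h₀'⟩ := ih
    obtain ⟨c₁, h₁, h₁'⟩ := exists_implements_layer_dilation (D := D) e h1 Matrix.isHermitian_one
    obtain ⟨c₂, h₂, h₂'⟩ := exists_implements_unitary e
      (layer_mem_unitaryGroup hS h1 Matrix.isHermitian_one)
    refine ⟨(c₂.seq c₁).seq c₀, by simp [QueryCircuit.numQueries, h₀, h₁, h₂]; ring, ?_⟩
    have := (h₂'.seq h₁').seq h₀'
    simp only [layer_mul _ _ h1, ← pow_succ] at this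
    exact this

open Matrix Polynomial in
/-- Layers act on `∑ j, v j (W) χ ⊗ |j⟩` as `(1 - Q) + z Q` acts on the polynomials `v`. -/
lemma layer_mulVec_aeval (W : Matrix (D × Fin 2) (D × Fin 2) ℂ) (Q : Matrix J J ℂ)
    {v v' : J → ℂ[X]}
    (hv : v = (1 - Q.map C : Matrix J J ℂ[X]) *ᵥ v' +
      (X : ℂ[X]) • ((Q.map C : Matrix J J ℂ[X]) *ᵥ v')) (χ : D × Fin 2 → ℂ) :
    (layer W Q *ᵥ fun x => (aeval W (v' x.2) *ᵥ χ) x.1) =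
      fun x => (aeval W (v x.2) *ᵥ χ) x.1 := by
  have hQ : (1 - Q.map C : Matrix J J ℂ[X]) = (1 - Q).map C := by
    rw [Matrix.map_sub _ (by simp), Matrix.map_one _ (by simp) (by simp)]
  have hmap (M : Matrix J J ℂ) (j : J) : aeval W (((M.map C : Matrix J J ℂ[X]) *ᵥ v') j) =
      ∑ i, M j i • aeval W (v' i) := by
    simp [mulVec, dotProduct, Algebra.algebraMap_eq_smul_one]
  ext ⟨k, j⟩
  have hk (B : Matrix (D × Fin 2) (D × Fin 2) ℂ) (M : Matrix J J ℂ) :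
      ((B ⊗ₖ M) *ᵥ fun x => (aeval W (v' x.2) *ᵥ χ) x.1) (k, j) =
        ((B * ∑ i, M j i • aeval W (v' i)) *ᵥ χ) k := by
    rw [kronecker_mulVec_apply]
    simp only [Finset.mul_sum, sum_mulVec, mul_smul_comm, smul_mulVec, ← mulVec_mulVec,
      Finset.sum_apply, Pi.smul_apply, smul_eq_mul]
  rw [layer, add_mulVec, Pi.add_apply, hk, hk, hv, hQ]
  simp only [Pi.add_apply, map_add, Pi.smul_apply, smul_eq_mul, map_mul, aeval_X, hmap,
    add_mulVec, one_mul]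
  rw [add_comm]

open Matrix Polynomial in
/-- **Quantum signal processing** for vector-valued polynomials `v` of unit length on the circle:
`χ ⊗ |j₀⟩` is mapped to `∑ j, v j (W) χ ⊗ |j⟩`, where `W` is the walk operator `S · dilation U`. -/
theorem exists_implements_aeval (e : R ≃ Fin 2 × J) {S : Matrix (D × Fin 2) (D × Fin 2) ℂ}
    (hS : S ∈ unitaryGroup (D × Fin 2) ℂ) (j₀ : J) (n : ℕ) {v : J → ℂ[X]}
    (hv : ∀ j, (v j).natDegree ≤ n) (hu : ∀ z : ℂ, ‖z‖ = 1 → ∑ j, ‖(v j).eval z‖ ^ 2 = 1) :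
    ∃ (c : QueryCircuit D R) (M : _), c.numQueries = 2 * n ∧ Implements e c M ∧
      ∀ U χ, (M U *ᵥ fun x => if x.2 = j₀ then χ x.1 else 0) =
        fun x => (aeval (S * dilation (U : Matrix D D ℂ)) (v x.2) *ᵥ χ) x.1 := by
  induction n generalizing v with
  | zero =>
    have hC (j : J) : v j = C ((v j).coeff 0) :=
      eq_C_of_natDegree_eq_zero (Nat.le_zero.1 (hv j))
    obtain ⟨V, hV, hVj⟩ := exists_unitary_column (u := fun j => (v j).coeff 0) (by
      have := hu 1 (by simp)
      refine Eq.trans (Finset.sum_congr rfl fun j _ => ?_) this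
      rw [hC j]; simp) j₀
    obtain ⟨c, h, h'⟩ := exists_implements_unitary e
      (kronecker_mem_unitary (one_mem (unitaryGroup (D × Fin 2) ℂ)) hV)
    refine ⟨c, _, h, h', fun U χ => ?_⟩
    ext ⟨k, j⟩
    rw [hC j]
    simp [mulVec, dotProduct, Fintype.sum_prod_type, hVj, one_apply,
      Algebra.algebraMap_eq_smul_one, mul_comm]
  | succ n ih =>
    obtain ⟨Q, v', hQ, hQ', hv', hu', hvv'⟩ := exists_layer_stripping hv hu
    obtain ⟨c, M, h, h', hM⟩ := ih hv' hu'
    obtain ⟨c₁, h₁, h₁'⟩ := exists_implements_layer_walk e hS hQ hQ'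
    refine ⟨c.seq c₁, _, by simp [QueryCircuit.numQueries, h, h₁]; ring, h'.seq h₁',
      fun U χ => ?_⟩
    rw [← mulVec_mulVec, hM, layer_mulVec_aeval _ _ hvv']

end

/-! ### Polynomials in `(z + z⁻¹) / 2` -/

open Polynomial in
/-- The polynomial `z ^ d * P ((z + z⁻¹) / 2)`, for `P` of degree at most `d`. -/
noncomputable def joukowski (d : ℕ) (P : ℂ[X]) : ℂ[X] :=
  ∑ k ∈ Finset.range (d + 1), C (P.coeff k / 2 ^ k) * (X ^ (d - k) * (X ^ 2 + 1) ^ k)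

open Polynomial in
lemma natDegree_joukowski_le (d : ℕ) (P : ℂ[X]) : (joukowski d P).natDegree ≤ 2 * d := by
  refine natDegree_sum_le_of_forall_le _ _ fun k hk => ?_
  have hk' : k ≤ d := Nat.lt_succ_iff.1 (Finset.mem_range.1 hk)
  refine (natDegree_C_mul_le _ _).trans (natDegree_mul_le.trans ?_)
  have h1 : ((X : ℂ[X]) ^ (d - k)).natDegree ≤ d - k := natDegree_X_pow_le _
  have h2 : (((X : ℂ[X]) ^ 2 + 1) ^ k).natDegree ≤ k * 2 :=
    natDegree_pow_le_of_le k (by compute_degree)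
  omega

open Polynomial in
lemma eval_joukowski {d : ℕ} {P : ℂ[X]} (hP : P.natDegree ≤ d) {z : ℂ} (hz : ‖z‖ = 1) :
    (joukowski d P).eval z = z ^ d * P.eval (z.re : ℂ) := by
  have h : z ^ 2 + 1 = 2 * z.re * z := by
    have h1 : (starRingEnd ℂ) z * z = 1 := by rw [Complex.conj_mul', hz]; simp
    have h2 : (2 * z.re : ℂ) = z + (starRingEnd ℂ) z := by rw [Complex.add_conj]; push_cast; ring
    rw [h2]; linear_combination -h1
  rw [joukowski, eval_finsetSum, eval_eq_sum_range' (Nat.lt_succ_of_le hP), Finset.mul_sum]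
  refine Finset.sum_congr rfl fun k hk => ?_
  have hk' : k ≤ d := Nat.lt_succ_iff.1 (Finset.mem_range.1 hk)
  simp only [eval_mul, eval_C, eval_pow, eval_X, eval_add, eval_one, h]
  rw [mul_pow, mul_pow]
  conv_rhs => rw [← Nat.sub_add_cancel hk', pow_add]
  field_simp

section

set_option linter.unusedSectionVars false

variable {K : Type} [Fintype K] [DecidableEq K]

open Polynomial Matrix in
lemma aeval_joukowski_mulVec {d : ℕ} {P : ℂ[X]} (hP : P.natDegree ≤ d) {W : Matrix K K ℂ}
    {χ : K → ℂ} {t : ℂ} (h : (W ^ 2 + 1) *ᵥ χ = (2 * t) • (W *ᵥ χ)) :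
    aeval W (joukowski d P) *ᵥ χ = P.eval t • (W ^ d *ᵥ χ) := by
  have hk (k : ℕ) : (W ^ 2 + 1) ^ k *ᵥ χ = (2 * t) ^ k • (W ^ k *ᵥ χ) := by
    induction k with
    | zero => simp
    | succ k ih =>
      have hc : (W ^ 2 + 1) * W ^ k = W ^ k * (W ^ 2 + 1) :=
        ((Commute.pow_pow_self W 2 k).add_left (Commute.one_left _)).eq
      rw [pow_succ', ← mulVec_mulVec, ih, mulVec_smul, mulVec_mulVec, hc, ← mulVec_mulVec, h,
        mulVec_smul, mulVec_mulVec, ← pow_succ, smul_smul, ← pow_succ]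
  rw [joukowski, map_sum, sum_mulVec, eval_eq_sum_range' (Nat.lt_succ_of_le hP), Finset.sum_smul]
  refine Finset.sum_congr rfl fun k hkd => ?_
  have hk' : k ≤ d := Nat.lt_succ_iff.1 (Finset.mem_range.1 hkd)
  simp only [map_mul, aeval_C, map_pow, aeval_X, map_add, map_one, Algebra.algebraMap_eq_smul_one,
    smul_mul_assoc, one_mul, smul_mulVec]
  rw [← mulVec_mulVec, hk, mulVec_smul, mulVec_mulVec, ← pow_add, Nat.sub_add_cancel hk', smul_smul]
  congr 1
  rw [mul_pow]; field_simp

/-! ### The quantum walk of a block-encoding -/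

open Matrix in
/-- If `T` is an involution whose compression by the projection `P` has the eigenvector `χ`, then
the walk operator `W = (2 P - 1) T` satisfies `W + W⁻¹ = 2 t` on `χ`. -/
lemma walk_sq_add_one_mulVec {P T : Matrix K K ℂ} (hT : T * T = 1) {χ : K → ℂ} {t : ℂ}
    (hP : P *ᵥ χ = χ) (hPT : P *ᵥ (T *ᵥ χ) = t • χ) :
    (((2 * P - 1) * T) ^ 2 + 1) *ᵥ χ = (2 * t) • (((2 * P - 1) * T) *ᵥ χ) := by
  have hS (y : K → ℂ) : (2 * P - 1) *ᵥ y = (2 : ℂ) • (P *ᵥ y) - y := by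
    rw [sub_mulVec, one_mulVec, two_mul, add_mulVec, two_smul]
  have h1 : ((2 * P - 1) * T) *ᵥ χ = (2 * t) • χ - T *ᵥ χ := by
    rw [← mulVec_mulVec, hS, hPT, smul_smul]
  have h2 : ((2 * P - 1) * T) *ᵥ (T *ᵥ χ) = χ := by
    rw [mulVec_mulVec, mul_assoc, hT, mul_one, hS, hP, two_smul, add_sub_cancel_right]
  rw [add_mulVec, one_mulVec, pow_two, ← mulVec_mulVec, h1, mulVec_sub, h2, mulVec_smul, h1]
  abel

lemma mul_pow_mul_mul_pow_of_involution {S T : Matrix K K ℂ} (hS : S * S = 1) (hT : T * T = 1)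
    (n : ℕ) : (T * S) ^ n * (S * T) ^ n = 1 := by
  induction n with
  | zero => simp
  | succ n ih =>
    rw [pow_succ, pow_succ', mul_assoc, ← mul_assoc (T * S) (S * T), mul_assoc T S,
      ← mul_assoc S S, hS, one_mul, hT, one_mul, ih]

end

section

variable {a s : ℕ}

/-- The vector `|0⟩ ⊗ φ ⊗ |+⟩`. -/
noncomputable def plusVec (a : ℕ) (φ : Qubits s → ℂ) : (Qubits a × Qubits s) × Fin 2 → ℂ :=
  fun k => if k.1.1 = 0 then φ k.1.2 * ((√2 : ℝ) : ℂ)⁻¹ else 0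

/-- The projection onto the vectors `|0⟩ ⊗ φ ⊗ |+⟩`. -/
noncomputable def plusProj (a s : ℕ) :
    Matrix ((Qubits a × Qubits s) × Fin 2) ((Qubits a × Qubits s) × Fin 2) ℂ :=
  (Matrix.single 0 0 1 ⊗ₖ (1 : Matrix (Qubits s) (Qubits s) ℂ)) ⊗ₖ !![1 / 2, 1 / 2; 1 / 2, 1 / 2]

lemma plusProj_mul_self : plusProj a s * plusProj a s = plusProj a s := by
  rw [plusProj, ← Matrix.mul_kronecker_mul, ← Matrix.mul_kronecker_mul,
    Matrix.single_mul_single_same, one_mul, one_mul]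
  congr 1
  ext i j
  fin_cases i <;> fin_cases j <;> norm_num [Matrix.mul_apply]

lemma isHermitian_plusProj : (plusProj a s).IsHermitian := by
  rw [Matrix.IsHermitian, plusProj, Matrix.conjTranspose_kronecker, Matrix.conjTranspose_kronecker,
    Matrix.conjTranspose_single, Matrix.conjTranspose_one, star_one]
  congr 1
  ext i j
  fin_cases i <;> fin_cases j <;> simp

lemma plusProj_mulVec (χ : (Qubits a × Qubits s) × Fin 2 → ℂ) (i : Qubits a) (j : Qubits s)
    (q : Fin 2) : (plusProj a s).mulVec χ ((i, j), q) =
      if i = 0 then (χ ((0, j), 0) + χ ((0, j), 1)) / 2 else 0 := by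
  have h (y : Qubits a × Qubits s → ℂ) :
      (Matrix.single (0 : Qubits a) (0 : Qubits a) (1 : ℂ) ⊗ₖ
        (1 : Matrix (Qubits s) (Qubits s) ℂ)).mulVec y (i, j) = if i = 0 then y (0, j) else 0 := by
    rw [kronecker_mulVec_apply]
    simp [Matrix.one_apply, Matrix.single_mulVec, Function.update_apply]
  rw [plusProj, kronecker_mulVec_apply]
  simp only [h]
  fin_cases q <;> split_ifs <;> simp <;> ring

lemma plusReflection_mul_self :
    (2 * plusProj a s - 1) * (2 * plusProj a s - 1) = 1 := by
  have h := plusProj_mul_self (a := a) (s := s)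
  have : (2 * plusProj a s - 1) * (2 * plusProj a s - 1) =
    4 * (plusProj a s * plusProj a s) - 4 * plusProj a s + 1 := by noncomm_ring
  rw [this, h, sub_self, zero_add]

lemma plusReflection_mem_unitaryGroup :
    2 * plusProj a s - 1 ∈ Matrix.unitaryGroup ((Qubits a × Qubits s) × Fin 2) ℂ := by
  have h : star (2 * plusProj a s - 1) = 2 * plusProj a s - 1 := by
    rw [two_mul, Matrix.star_eq_conjTranspose, Matrix.conjTranspose_sub, Matrix.conjTranspose_add,
      isHermitian_plusProj.eq, Matrix.conjTranspose_one]
  rw [Matrix.mem_unitaryGroup_iff, h, plusReflection_mul_self]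

/-- The compression `⟨0| M |0⟩` to the system register. -/
def zeroBlock (M : Matrix (Qubits a × Qubits s) (Qubits a × Qubits s) ℂ) :
    Matrix (Qubits s) (Qubits s) ℂ :=
  Matrix.of fun i j => M (0, i) (0, j)

lemma mulVec_plusVec_zero (M : Matrix (Qubits a × Qubits s) (Qubits a × Qubits s) ℂ)
    (φ : Qubits s → ℂ) (j : Qubits s) (q : Fin 2) :
    M.mulVec (fun d => plusVec a φ (d, q)) (0, j) =
      (zeroBlock M).mulVec φ j * ((√2 : ℝ) : ℂ)⁻¹ := by
  simp [Matrix.mulVec, dotProduct, Fintype.sum_prod_type, plusVec, zeroBlock, Finset.sum_mul,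
    mul_assoc]

/-- Eigenvectors of the compression of `U` satisfy the three-term recurrence of the walk. -/
lemma walk_recurrence (U : Matrix.unitaryGroup (Qubits a × Qubits s) ℂ) {φ : Qubits s → ℂ} {t : ℂ}
    (h : (zeroBlock U.1).mulVec φ = t • φ) (h' : (zeroBlock (star U.1)).mulVec φ = t • φ) :
    (((2 * plusProj a s - 1) * dilation U.1) ^ 2 + 1).mulVec (plusVec a φ) =
      (2 * t) • ((2 * plusProj a s - 1) * dilation U.1).mulVec (plusVec a φ) := by
  refine walk_sq_add_one_mulVec (dilation_mul_self U) ?_ ?_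
  · ext ⟨⟨i, j⟩, q⟩
    rw [plusProj_mulVec]
    simp [plusVec]
  · ext ⟨⟨i, j⟩, q⟩
    rw [plusProj_mulVec, dilation_mulVec, dilation_mulVec]
    simp only [Matrix.cons_val_zero, Matrix.cons_val_one, mulVec_plusVec_zero, h, h',
      Pi.smul_apply, smul_eq_mul]
    simp only [plusVec]
    split_ifs
    · ring
    · simp

end

/-! ### The circuit of a polynomial path -/

/-- Splitting of the flag qubit and a workspace of two qubits: the second qubit of the workspace
carries the Hermitian dilation, and the flag qubit and the first qubit of the workspace label the
coordinates of the polynomial path. -/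
def workspaceEquiv : Fin 2 × Qubits 2 ≃ Fin 2 × (Fin 2 × Fin 2) where
  toFun x := (x.2 1, (x.1, x.2 0))
  invFun y := (y.2.1, ![y.2.2, y.1])
  left_inv x := by
    ext i <;> simp
    fin_cases i <;> rfl
  right_inv y := by simp

lemma layer_one_mulVec {K J : Type} [Fintype K] [DecidableEq K] [Fintype J] [DecidableEq J]
    (B : Matrix K K ℂ) (Ψ : K × J → ℂ) (k : K) (j : J) :
    (layer B (1 : Matrix J J ℂ)).mulVec Ψ (k, j) = B.mulVec (fun k => Ψ (k, j)) k := by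
  rw [layer, sub_self, Matrix.kronecker_zero, add_zero, kronecker_mulVec_apply]
  simp [Matrix.one_apply]

/-- The Hadamard gate. -/
noncomputable def hadamard : Matrix (Fin 2) (Fin 2) ℂ :=
  ((√2 : ℝ) : ℂ)⁻¹ • !![1, 1; 1, -1]

lemma inv_sqrt_two_mul_self : ((√2 : ℝ) : ℂ)⁻¹ * ((√2 : ℝ) : ℂ)⁻¹ = 1 / 2 := by
  rw [← mul_inv, ← Complex.ofReal_mul, Real.mul_self_sqrt (by norm_num)]
  norm_num

lemma hadamard_mem_unitaryGroup : hadamard ∈ Matrix.unitaryGroup (Fin 2) ℂ := by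
  have h := inv_sqrt_two_mul_self
  rw [Matrix.mem_unitaryGroup_iff]
  ext i j
  fin_cases i <;> fin_cases j <;>
    simp [hadamard, Matrix.star_eq_conjTranspose, Matrix.mul_apply] <;>
    linear_combination 2 * h

lemma gpeState_apply (a w : ℕ) {s : ℕ} (ξ : StateVec (Fin 2)) (ψ : StateVec (Qubits s)) (c : Fin 2)
    (i : Qubits a) (j : Qubits s) (f : Fin 2) (ω : Qubits w) :
    gpeState a w ξ ψ (c, ((i, j), (f, ω))) =
      if c = 0 ∧ i = 0 ∧ ω = 0 then ξ f * ψ j else 0 := by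
  simp only [gpeState, tensorVec, ket, PiLp.single_apply]
  split_ifs <;> simp_all
  ring

lemma gpeState_eq_embed (a : ℕ) {s : ℕ} (ψ : StateVec (Qubits s)) :
    WithLp.ofLp (gpeState a 2 (ket 0) ψ) = embed workspaceEquiv
      ![fun x => if x.1.1.1 = 0 ∧ x.1.2 = 0 ∧ x.2 = (0, 0) then ψ x.1.1.2 else 0, 0] := by
  ext ⟨c, ⟨i, j⟩, f, ω⟩
  have hω : ω = 0 ↔ ω 0 = 0 ∧ ω 1 = 0 := by
    rw [funext_iff, Fin.forall_fin_two]; rfl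
  rw [gpeState_apply]
  fin_cases c
  · simp only [ket, PiLp.single_apply, hω, embed, splitEquiv, workspaceEquiv]
    by_cases hf : f = 0 <;> simp [hf, and_comm]
  · simp [embed]

open Polynomial in
/-- A polynomial path of unit vectors in `ℂ² ⊕ ℂ` gives a circuit, of query number proportional to
its degree, that maps eigenvectors of the encoded operator along the path. The third component of
the path is `f + i √(1 - x²) h`. -/
theorem exists_circuit_of_path (a s : ℕ) {d : ℕ} {P : Fin 2 → ℂ[X]} {f h : ℝ[X]}
    (hP : ∀ i, (P i).natDegree ≤ d) (hf : f.natDegree ≤ d) (hh : h.natDegree ≤ d)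
    (hunit : ∀ x : ℝ, ‖(P 0).eval (x : ℂ)‖ ^ 2 + ‖(P 1).eval (x : ℂ)‖ ^ 2 +
      (f.eval x ^ 2 + (1 - x ^ 2) * h.eval x ^ 2) = 1) :
    ∃ c : QueryCircuit (Qubits a × Qubits s) (Fin 2 × Qubits 2), c.numQueries = 6 * (d + 1) ∧
      ∀ (U : Matrix.unitaryGroup (Qubits a × Qubits s) ℂ) (φ : StateVec (Qubits s)) (t : ℂ),
        (zeroBlock U.1).mulVec φ = t • φ.ofLp → (zeroBlock (star U.1)).mulVec φ = t • φ.ofLp →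
        ∀ i j, (c.toMatrix U).mulVec (gpeState a 2 (ket 0) φ) (0, ((0, j), (i, 0))) =
          (P i).eval t * φ j := by
  -- On the circle, `√(1 - x²)` for `x = re z` is realized by `im z = (z - z⁻¹) / (2 i)`; all
  -- entries carry the common factor `z ^ (d + 1)`.
  set r : ℂ[X] := X * joukowski d (f.map Complex.ofRealHom) +
    C (1 / 2) * ((X ^ 2 - 1) * joukowski d (h.map Complex.ofRealHom)) with hr
  set v : Fin 2 × Fin 2 → ℂ[X] := fun x =>
    if x.2 = 0 then X * joukowski d (P x.1) else if x.1 = 0 then r else 0 with hv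
  have hjd (Q : ℂ[X]) : (joukowski d Q).natDegree ≤ 2 * d := natDegree_joukowski_le d Q
  have hvd (x : Fin 2 × Fin 2) : (v x).natDegree ≤ 2 * d + 2 := by
    have h1 (Q : ℂ[X]) : (X * joukowski d Q).natDegree ≤ 2 * d + 2 :=
      natDegree_mul_le.trans (by rw [natDegree_X]; have := hjd Q; omega)
    have h2 : r.natDegree ≤ 2 * d + 2 := by
      refine (natDegree_add_le _ _).trans (max_le (h1 _) ((natDegree_C_mul_le _ _).trans ?_))
      have : ((X : ℂ[X]) ^ 2 - 1).natDegree ≤ 2 := by compute_degree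
      exact natDegree_mul_le.trans (by have := hjd (h.map Complex.ofRealHom); omega)
    simp only [hv]
    split_ifs
    · exact h1 _
    · exact h2
    · simp
  have hvu (z : ℂ) (hz : ‖z‖ = 1) : ∑ x, ‖(v x).eval z‖ ^ 2 = 1 := by
    have h1 (i : Fin 2) : ‖(X * joukowski d (P i)).eval z‖ = ‖(P i).eval (z.re : ℂ)‖ := by
      rw [eval_mul, eval_joukowski (hP i) hz, eval_X, norm_mul, norm_mul, norm_pow, hz]
      simp
    have hreal (g : ℝ[X]) (hg : g.natDegree ≤ d) :
        (joukowski d (g.map Complex.ofRealHom)).eval z = z ^ d * ((g.eval z.re : ℝ) : ℂ) := by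
      rw [eval_joukowski (natDegree_map_le.trans hg) hz]
      congr 1
      exact eval_map_apply Complex.ofRealHom z.re
    have hn : z.re ^ 2 + z.im ^ 2 = 1 := by
      have := Complex.sq_norm z
      rw [hz, Complex.normSq_apply] at this
      linarith
    have h2 : ‖r.eval z‖ ^ 2 = f.eval z.re ^ 2 + (1 - z.re ^ 2) * h.eval z.re ^ 2 := by
      have h3 : r.eval z = z ^ (d + 1) *
          ((f.eval z.re : ℝ) + ((z.im * h.eval z.re : ℝ) : ℂ) * Complex.I) := by
        have hz1 : z ^ 2 - 1 = 2 * z.im * Complex.I * z := by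
          have h1 : (starRingEnd ℂ) z * z = 1 := by rw [Complex.conj_mul', hz]; simp
          have h2 : (2 * z.im * Complex.I : ℂ) = z - (starRingEnd ℂ) z := by
            rw [Complex.sub_conj]; push_cast; ring
          rw [h2]; linear_combination h1
        simp only [hr, eval_add, eval_mul, eval_X, eval_C, eval_sub, eval_pow, eval_one,
          hreal f hf, hreal h hh, hz1]
        push_cast
        ring
      rw [h3, norm_mul, norm_pow, hz, one_pow, one_mul, Complex.sq_norm,
        Complex.normSq_add_mul_I]
      linear_combination (h.eval z.re ^ 2) * hn
    simp only [Fintype.sum_prod_type, Fin.sum_univ_two, hv]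
    simp [-eval_mul, h1, h2]
    linarith [hunit z.re]
  have hS := plusReflection_mem_unitaryGroup (a := a) (s := s)
  obtain ⟨c₁, h₁, h₁'⟩ := exists_implements_unitary workspaceEquiv (layer_mem_unitaryGroup
    (Matrix.kronecker_mem_unitary (one_mem (Matrix.unitaryGroup (Qubits a × Qubits s) ℂ))
    hadamard_mem_unitaryGroup) (one_mul 1) Matrix.isHermitian_one)
  obtain ⟨c₂, M, h₂, h₂', hM⟩ := exists_implements_aeval workspaceEquiv hS (0, 0) _ hvd hvu
  obtain ⟨c₃, h₃, h₃'⟩ := exists_implements_walk_inv_pow (J := Fin 2 × Fin 2) workspaceEquiv hS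
    (d + 1)
  refine ⟨((c₁.seq c₂).seq c₃).seq c₁, by simp [QueryCircuit.numQueries, h₁, h₂, h₃]; ring,
    fun U φ t ht ht' i j => ?_⟩
  have hprep : (layer ((1 : Matrix (Qubits a × Qubits s) (Qubits a × Qubits s) ℂ) ⊗ₖ hadamard)
      (1 : Matrix (Fin 2 × Fin 2) (Fin 2 × Fin 2) ℂ)).mulVec
      (fun x => if x.1.1.1 = 0 ∧ x.1.2 = 0 ∧ x.2 = (0, 0) then φ x.1.1.2 else 0) =
      fun x => if x.2 = (0, 0) then plusVec a φ x.1 else 0 := by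
    ext ⟨⟨⟨i, j⟩, q⟩, m⟩
    rw [layer_one_mulVec, kronecker_mulVec_apply]
    by_cases hm : m = (0, 0) <;> by_cases hi : i = 0 <;> fin_cases q <;>
      simp [hm, hi, plusVec, hadamard, mul_comm]
  have hinv := mul_pow_mul_mul_pow_of_involution (plusReflection_mul_self (a := a) (s := s))
    (dilation_mul_self U) (d + 1)
  -- In the components with second label `0`, the inverse walk removes the factor `W ^ (d + 1)`.
  have hcomp : (fun k => (layer ((dilation U.1 * (2 * plusProj a s - 1)) ^ (d + 1))
      (1 : Matrix (Fin 2 × Fin 2) (Fin 2 × Fin 2) ℂ)).mulVec (fun x => ((aeval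
        ((2 * plusProj a s - 1) * dilation U.1)) (v x.2)).mulVec (plusVec a φ) x.1) (k, (i, 0))) =
      (P i).eval t • plusVec a φ := by
    ext k
    rw [layer_one_mulVec]
    simp only [hv, if_true, map_mul, aeval_X]
    rw [← Matrix.mulVec_mulVec, aeval_joukowski_mulVec (hP i) (walk_recurrence U ht ht'),
      Matrix.mulVec_smul, Matrix.mulVec_mulVec, ← pow_succ', Matrix.mulVec_smul,
      Matrix.mulVec_mulVec, hinv, Matrix.one_mulVec]
  rw [gpeState_eq_embed, ((h₁'.seq h₂').seq h₃').seq h₁', ← Matrix.mulVec_mulVec,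
    ← Matrix.mulVec_mulVec, ← Matrix.mulVec_mulVec, hprep, hM]
  simp only [embed, Matrix.cons_val_zero]
  rw [show splitEquiv (Qubits a × Qubits s) workspaceEquiv ((0, j), (i, 0)) =
    (((0, j), 0), (i, 0)) from rfl, layer_one_mulVec, hcomp, kronecker_mulVec_apply]
  simp only [Fin.sum_univ_two, Matrix.one_mulVec, Pi.smul_apply, smul_eq_mul, plusVec, hadamard,
    if_true, Matrix.smul_apply]
  have h := inv_sqrt_two_mul_self
  simp
  linear_combination 2 * (P i).eval t * φ j * h

/-! ### Comparison of isometries -/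

section

set_option linter.unusedSectionVars false

lemma controlled_mem_unitaryGroup {D R : Type} [Fintype D] [DecidableEq D] [Fintype R]
    [DecidableEq R] {M : Matrix D D ℂ} (hM : M ∈ Matrix.unitaryGroup D ℂ) :
    controlled R M ∈ Matrix.unitaryGroup (Fin 2 × (D × R)) ℂ := by
  have h := Matrix.mem_unitaryGroup_iff.1 hM
  rw [Matrix.star_eq_conjTranspose] at h
  rw [Matrix.mem_unitaryGroup_iff, Matrix.star_eq_conjTranspose, controlled,
    Matrix.conjTranspose_add]
  simp only [Matrix.conjTranspose_kronecker, Matrix.conjTranspose_single, Matrix.conjTranspose_one,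
    star_one, add_mul, mul_add, ← Matrix.mul_kronecker_mul, mul_one, h]
  simp only [Matrix.one_kronecker_one, Matrix.single_mul_single_same, mul_one]
  rw [Matrix.single_mul_single_of_ne, Matrix.single_mul_single_of_ne]
  · simp only [Matrix.zero_kronecker, zero_add, add_zero]
    rw [← Matrix.add_kronecker]
    convert Matrix.one_kronecker_one (α := ℂ)
    ext i j
    fin_cases i <;> fin_cases j <;> simp
  · simp
  · simp

lemma QueryCircuit.toMatrix_mem_unitaryGroup {D R : Type} [Fintype D] [DecidableEq D] [Fintype R]
    [DecidableEq R] (U : Matrix.unitaryGroup D ℂ) (c : QueryCircuit D R) :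
    c.toMatrix U ∈ Matrix.unitaryGroup (Fin 2 × (D × R)) ℂ := by
  induction c with
  | gate V => exact V.2
  | query => exact controlled_mem_unitaryGroup U.2
  | queryInv => exact controlled_mem_unitaryGroup (star U).2
  | seq c₁ c₂ h₁ h₂ => exact mul_mem h₂ h₁

lemma inner_toEuclideanLin_of_mem_unitaryGroup {n : Type} [Fintype n] [DecidableEq n]
    {M : Matrix n n ℂ} (hM : M ∈ Matrix.unitaryGroup n ℂ) (x y : StateVec n) :
    inner ℂ (Matrix.toEuclideanLin M x) (Matrix.toEuclideanLin M y) = inner ℂ x y := by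
  rw [← LinearMap.adjoint_inner_right, ← Matrix.toEuclideanLin_conjTranspose_eq_adjoint]
  congr 1
  rw [Matrix.toLpLin_apply, Matrix.toLpLin_apply, Matrix.mulVec_mulVec,
    ← Matrix.star_eq_conjTranspose, Matrix.mem_unitaryGroup_iff'.1 hM, Matrix.one_mulVec]

lemma inner_gpeState_left {a s w : ℕ} (ξ : StateVec (Fin 2)) (ψ : StateVec (Qubits s))
    (y : StateVec (Fin 2 × ((Qubits a × Qubits s) × (Fin 2 × Qubits w)))) :
    inner ℂ (gpeState a w ξ ψ) y =
      ∑ j, ∑ f, starRingEnd ℂ (ξ f * ψ j) * y (0, ((0, j), (f, 0))) := by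
  rw [PiLp.inner_apply]
  simp only [Fintype.sum_prod_type, gpeState_apply, RCLike.inner_apply]
  rw [Finset.sum_eq_single 0 (by intro c _ hc; simp [hc]) (by simp),
    Finset.sum_eq_single 0 (by intro c _ hc; simp [hc]) (by simp)]
  refine Finset.sum_congr rfl fun j _ => Finset.sum_congr rfl fun f _ => ?_
  rw [Finset.sum_eq_single 0 (by intro c _ hc; simp [hc]) (by simp)]
  simp [mul_comm]

lemma inner_gpeState {a s w : ℕ} (ξ ξ' : StateVec (Fin 2)) (ψ ψ' : StateVec (Qubits s)) :
    inner ℂ (gpeState a w ξ ψ) (gpeState a w ξ' ψ') = inner ℂ ξ ξ' * inner ℂ ψ ψ' := by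
  rw [inner_gpeState_left, PiLp.inner_apply, PiLp.inner_apply, mul_comm, Finset.sum_mul]
  refine Finset.sum_congr rfl fun j _ => ?_
  rw [Finset.mul_sum]
  refine Finset.sum_congr rfl fun f _ => ?_
  simp only [gpeState_apply, RCLike.inner_apply, map_mul]
  simp
  ring

/-- Two orthonormal families with mutual inner products `δ_{u u'} r u` have isometries at distance
at most `√(2 (1 - r))`, because their differences are orthogonal. -/
lemma norm_sum_sub_sum_sq_le {E ι : Type} [NormedAddCommGroup E] [InnerProductSpace ℂ E]
    [Fintype ι] [DecidableEq ι] {G T : ι → E} {r : ι → ℝ} {τ : ℝ} (hG : Orthonormal ℂ G)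
    (hT : Orthonormal ℂ T) (hGT : ∀ u u', inner ℂ (G u) (T u') = if u = u' then (r u : ℂ) else 0)
    (hr : ∀ u, 1 - τ ≤ r u) (c : ι → ℂ) :
    ‖∑ u, c u • T u - ∑ u, c u • G u‖ ^ 2 ≤ 2 * τ * ∑ u, ‖c u‖ ^ 2 := by
  have hTG (u u' : ι) : inner ℂ (T u) (G u') = if u = u' then (r u : ℂ) else 0 := by
    rw [← inner_conj_symm, hGT]
    split_ifs with h1 h2 h2
    · simp [h1]
    · exact absurd h1.symm h2
    · exact absurd h2.symm h1
    · simp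
  have h : inner ℂ (∑ u, c u • (T u - G u)) (∑ u, c u • (T u - G u)) =
      ((∑ u, (2 - 2 * r u) * ‖c u‖ ^ 2 : ℝ) : ℂ) := by
    rw [sum_inner]
    push_cast
    refine Finset.sum_congr rfl fun u _ => ?_
    rw [inner_sum, Finset.sum_eq_single u]
    · simp only [inner_smul_left, inner_smul_right, inner_sub_left, inner_sub_right, hTG, hGT,
        orthonormal_iff_ite.1 hG, orthonormal_iff_ite.1 hT, if_true]
      linear_combination (2 - 2 * (r u : ℂ)) * Complex.mul_conj' (c u)
    · intro u' _ hne
      simp [inner_smul_left, inner_smul_right, inner_sub_left, inner_sub_right, hTG, hGT,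
        orthonormal_iff_ite.1 hG, orthonormal_iff_ite.1 hT, hne.symm]
    · simp
  rw [← Finset.sum_sub_distrib]
  simp only [← smul_sub]
  rw [← inner_self_eq_norm_sq (𝕜 := ℂ), h]
  change (_ : ℝ) ≤ _
  rw [Finset.mul_sum]
  exact Finset.sum_le_sum fun u _ => mul_le_mul_of_nonneg_right (by linarith [hr u]) (sq_nonneg _)

end

/-! ### Spectral data of a block-encoding -/

section

variable {a s : ℕ} {ι : Type} [Fintype ι]

lemma ketBra_mulVec (v w : StateVec (Qubits s)) :
    (ketBra v).mulVec w = inner ℂ v w • v.ofLp := by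
  ext i
  simp only [Matrix.mulVec, dotProduct, ketBra, Matrix.of_apply, PiLp.inner_apply, Pi.smul_apply,
    smul_eq_mul, Finset.sum_mul, RCLike.inner_apply, RCLike.star_def]
  exact Finset.sum_congr rfl fun _ _ => by ring

lemma sum_ketBra_mulVec (ev : ι → ℝ) (b : OrthonormalBasis ι ℂ (StateVec (Qubits s))) (u : ι) :
    (∑ u, (ev u : ℂ) • ketBra (b u)).mulVec (b u) = (ev u : ℂ) • (b u).ofLp := by
  classical
  rw [Matrix.sum_mulVec, Finset.sum_eq_single u]
  · rw [Matrix.smul_mulVec, ketBra_mulVec, inner_self_eq_norm_sq_to_K, b.norm_eq_one]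
    simp
  · intro u' _ hne
    rw [Matrix.smul_mulVec, ketBra_mulVec, b.inner_eq_zero hne]
    simp
  · simp

lemma abs_eigenvalue_le_norm {A : Matrix (Qubits s) (Qubits s) ℂ} {t : ℝ}
    {v : StateVec (Qubits s)} (hv : ‖v‖ = 1) (h : A.mulVec v = (t : ℂ) • v.ofLp) : |t| ≤ ‖A‖ := by
  have h1 := Matrix.l2_opNorm_mulVec A v
  rw [h, hv, mul_one] at h1
  have h2 : (EuclideanSpace.equiv (Qubits s) ℂ).symm ((t : ℂ) • v.ofLp) = (t : ℂ) • v := rfl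
  rw [h2, norm_smul, hv, mul_one, Complex.norm_real] at h1
  exact h1

lemma isHermitian_sum_ketBra (ev : ι → ℝ) (b : ι → StateVec (Qubits s)) :
    (∑ u, (ev u : ℂ) • ketBra (b u)).IsHermitian := by
  rw [Matrix.IsHermitian, Matrix.conjTranspose_sum]
  refine Finset.sum_congr rfl fun u _ => ?_
  rw [Matrix.conjTranspose_smul]
  congr 1
  · simp
  · ext i j
    simp [ketBra, mul_comm]

lemma zeroBlock_of_isBlockEncoding {U : Matrix.unitaryGroup (Qubits a × Qubits s) ℂ}
    {A : Matrix (Qubits s) (Qubits s) ℂ} {α : ℝ} (h : IsBlockEncoding U A α 0) :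
    zeroBlock U.1 = (α : ℂ)⁻¹ • A := by
  obtain ⟨hα, -, h⟩ := h
  have h1 : A = (α : ℂ) • zeroBlock U.1 := by
    rw [← sub_eq_zero, ← norm_le_zero_iff]; exact h
  have hα' : (α : ℂ) ≠ 0 := by exact_mod_cast hα.ne'
  conv_rhs => rw [h1]
  rw [smul_smul, inv_mul_cancel₀ hα', one_smul]

lemma zeroBlock_star (M : Matrix (Qubits a × Qubits s) (Qubits a × Qubits s) ℂ) :
    zeroBlock (star M) = (zeroBlock M).conjTranspose := rfl

end

/-! ### Gapped phase estimation -/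

/-- Normalizing a vector of the unit ball keeps it near a unit vector `t`. -/
lemma norm_normalize_sub_le {y t : StateVec (Fin 2)} {δ ε : ℝ} (hy : ‖y‖ ≤ 1) (hy0 : 0 < ‖y‖)
    (ht : ‖t‖ = 1) (hδ : δ ≤ 1) (hty : 1 - δ ≤ (inner ℂ t y).re) (hε : 0 ≤ ε)
    (hδε : 2 * δ ≤ ε ^ 2) : ‖((‖y‖⁻¹ : ℝ) : ℂ) • y - t‖ ≤ ε := by
  have hn : ‖((‖y‖⁻¹ : ℝ) : ℂ) • y‖ = 1 := by
    rw [norm_smul, Complex.norm_real, norm_inv, norm_norm, inv_mul_cancel₀ hy0.ne']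
  have h1 : ‖((‖y‖⁻¹ : ℝ) : ℂ) • y - t‖ ^ 2 = 2 - 2 * (‖y‖⁻¹ * (inner ℂ t y).re) := by
    rw [norm_sub_rev, norm_sub_sq (𝕜 := ℂ), hn, ht, inner_smul_right]
    simp
    ring
  have h2 : 1 ≤ ‖y‖⁻¹ := (one_le_inv₀ hy0).2 hy
  have h3 : 1 - δ ≤ ‖y‖⁻¹ * (inner ℂ t y).re := by nlinarith
  exact abs_le_of_sq_le_sq' (by rw [h1]; linarith) hε |>.2

open Polynomial in
/-- The query circuit for fixed parameters: `η` is the accuracy of the polynomial path, and `n`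
controls its degree. Infidelity `O(η)` of unit vectors means distance `O(√η)`, whence the condition
`8 η ≤ ε²`. -/
theorem exists_gapped_phase_circuit {φ ε η : ℝ} (hφ : 0 < φ) (hφ1 : φ < 1) (hε : 0 < ε)
    (hη : 0 < η) (hη1 : η ≤ 1 / 8) (hηε : 8 * η ≤ ε ^ 2) {n : ℕ} (hn : 1 ≤ n)
    (hnη : 14 * (1 / 4 : ℝ) ^ n ≤ η / 2) (a s : ℕ) :
    ∃ c : QueryCircuit (Qubits a × Qubits s) (Fin 2 × Qubits 2),
      (c.numQueries : ℝ) ≤ 6 * (8 * (644 * n / φ) + 1) ∧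
      ∀ (U : Matrix.unitaryGroup (Qubits a × Qubits s) ℂ)
        (A : Matrix (Qubits s) (Qubits s) ℂ) (α : ℝ) (ι : Type) [Fintype ι] (ev : ι → ℝ)
        (b : OrthonormalBasis ι ℂ (StateVec (Qubits s))),
        A = ∑ u, (ev u : ℂ) • ketBra (b u) → IsBlockEncoding U A α 0 → 2 * ‖A‖ ≤ α →
        ∃ ξ : ι → StateVec (Fin 2),
          (∀ u, ‖ξ u‖ = 1) ∧
          (∀ u, ev u / α ∈ Set.Ico φ 1 → ‖ξ u - ket 0‖ ≤ ε) ∧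
          (∀ u, ev u / α ∈ Set.Icc (-(φ / 2)) (φ / 2) → ‖ξ u - Complex.I • ket 1‖ ≤ ε) ∧
          (∀ u, ev u / α ∈ Set.Ioc (-1) (-φ) → ‖ξ u - (-ket 0)‖ ≤ ε) ∧
          ∀ ψ : StateVec (Qubits s),
            ‖Matrix.toEuclideanLin (c.toMatrix U) (gpeState a 2 (ket 0) ψ) -
                ∑ u, inner ℂ (b u) ψ • gpeState a 2 (ξ u) (b u)‖ ≤ ε * ‖ψ‖ := by
  obtain ⟨p₀, p₁, p₂, p₃, f, h, d, hd, hd₀, hd₁, hd₂, hd₃, hdf, hdh, hsum, hlow, hright, hmid,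
    hleft⟩ := exists_quaternion_path hφ hφ1 hη (by linarith) hn hnη
  -- The quaternion `p` as an element of `ℂ²`, with `1` and `i` corresponding to `i|1⟩` and `|0⟩`.
  set P : Fin 2 → ℂ[X] := ![p₁.map Complex.ofRealHom + C Complex.I * p₃.map Complex.ofRealHom,
    C Complex.I * p₀.map Complex.ofRealHom - p₂.map Complex.ofRealHom] with hP
  have hev (p : ℝ[X]) (x : ℝ) : (p.map Complex.ofRealHom).eval (x : ℂ) = ((p.eval x : ℝ) : ℂ) :=
    eval_map_apply Complex.ofRealHom x
  have hP0 (x : ℝ) : (P 0).eval (x : ℂ) = (p₁.eval x : ℝ) + (p₃.eval x : ℝ) * Complex.I := by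
    simp [hP, hev, mul_comm]
  have hP1 (x : ℝ) :
      (P 1).eval (x : ℂ) = ((-p₂.eval x : ℝ) : ℂ) + (p₀.eval x : ℝ) * Complex.I := by
    simp [hP, hev]; ring
  have hN0 (x : ℝ) : ‖(P 0).eval (x : ℂ)‖ ^ 2 = p₁.eval x ^ 2 + p₃.eval x ^ 2 := by
    rw [hP0, Complex.sq_norm, Complex.normSq_add_mul_I]
  have hN1 (x : ℝ) : ‖(P 1).eval (x : ℂ)‖ ^ 2 = p₂.eval x ^ 2 + p₀.eval x ^ 2 := by
    rw [hP1, Complex.sq_norm, Complex.normSq_add_mul_I, neg_sq]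
  have hsumx (x : ℝ) : p₀.eval x ^ 2 + p₁.eval x ^ 2 + p₂.eval x ^ 2 + p₃.eval x ^ 2 +
      (f.eval x ^ 2 + (1 - x ^ 2) * h.eval x ^ 2) = 1 := by
    simpa using congrArg (eval x) hsum
  have hPd (i : Fin 2) : (P i).natDegree ≤ d := by
    have hm {p : ℝ[X]} (hp : p.natDegree ≤ d) : (p.map Complex.ofRealHom).natDegree ≤ d :=
      natDegree_map_le.trans hp
    fin_cases i
    · exact (natDegree_add_le _ _).trans (max_le (hm hd₁) ((natDegree_C_mul_le _ _).trans (hm hd₃)))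
    · exact (natDegree_sub_le _ _).trans (max_le ((natDegree_C_mul_le _ _).trans (hm hd₀)) (hm hd₂))
  obtain ⟨c, hc, hcU⟩ := exists_circuit_of_path a s hPd hdf hdh (fun x => by
    rw [hN0, hN1]; linarith [hsumx x])
  refine ⟨c, by rw [hc]; push_cast; linarith, fun U A α ι _ ev b hA hU hAα => ?_⟩
  classical
  have hα : 0 < α := hU.1
  set x : ι → ℝ := fun u => ev u / α with hx
  have hAb (u : ι) : A.mulVec (b u) = (ev u : ℂ) • (b u).ofLp := hA ▸ sum_ketBra_mulVec ev b u
  have hxabs (u : ι) : |x u| ≤ 1 / 2 := by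
    rw [hx, abs_div, abs_of_pos hα, div_le_iff₀ hα]
    linarith [abs_eigenvalue_le_norm (b.norm_eq_one u) (hAb u)]
  have hx' (u : ι) : x u ∈ Set.Icc (-(1 / 2) : ℝ) (1 / 2) := abs_le.1 (hxabs u)
  have hx1 (u : ι) : x u ∈ Set.Icc (-1 : ℝ) 1 := by
    constructor <;> linarith [(hx' u).1, (hx' u).2]
  have hB := zeroBlock_of_isBlockEncoding hU
  have hB1 (u : ι) : (zeroBlock U.1).mulVec (b u) = (x u : ℂ) • (b u).ofLp := by
    rw [hB, Matrix.smul_mulVec, hAb, smul_smul, hx]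
    push_cast
    rw [div_eq_inv_mul]
  have hB2 (u : ι) : (zeroBlock (star U.1)).mulVec (b u) = (x u : ℂ) • (b u).ofLp := by
    rw [zeroBlock_star, hB, Matrix.conjTranspose_smul, hA, (isHermitian_sum_ketBra ev b).eq, ← hA]
    rw [← hB1, hB]
    simp
  set y : ι → StateVec (Fin 2) := fun u => WithLp.toLp 2 fun i => (P i).eval (x u : ℂ) with hy
  have hyn (u : ι) : ‖y u‖ ^ 2 = p₀.eval (x u) ^ 2 + p₁.eval (x u) ^ 2 + p₂.eval (x u) ^ 2 +
      p₃.eval (x u) ^ 2 := by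
    rw [EuclideanSpace.norm_sq_eq, Fin.sum_univ_two]
    simp only [hy, hN0, hN1]
    ring
  have hy1 (u : ι) : ‖y u‖ ≤ 1 := by
    have h1 : ‖y u‖ ^ 2 ≤ 1 := by
      rw [hyn]
      have h2 := hsumx (x u)
      have h3 : 0 ≤ 1 - x u ^ 2 := by nlinarith [(hx1 u).1, (hx1 u).2]
      have := mul_nonneg h3 (sq_nonneg (h.eval (x u)))
      linarith [sq_nonneg (f.eval (x u))]
    nlinarith [norm_nonneg (y u)]
  have hylow (u : ι) : 1 - 4 * η ≤ ‖y u‖ := by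
    have := hlow (x u) (hx' u)
    rw [← hyn] at this
    nlinarith [hy1 u, norm_nonneg (y u)]
  have hypos (u : ι) : 0 < ‖y u‖ := by linarith [hylow u]
  have hclose (u : ι) {t : StateVec (Fin 2)} (ht : ‖t‖ = 1)
      (hty : 1 - 3 * η ≤ (inner ℂ t (y u)).re) : ‖((‖y u‖⁻¹ : ℝ) : ℂ) • y u - t‖ ≤ ε :=
    norm_normalize_sub_le (hy1 u) (hypos u) ht (by linarith) hty hε.le (by linarith)
  have hket (i : Fin 2) : ‖(ket i : StateVec (Fin 2))‖ = 1 := by simp [ket]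
  have hξ1 (u : ι) : ‖((‖y u‖⁻¹ : ℝ) : ℂ) • y u‖ = 1 := by
    rw [norm_smul, Complex.norm_real, norm_inv, norm_norm, inv_mul_cancel₀ (hypos u).ne']
  refine ⟨fun u => ((‖y u‖⁻¹ : ℝ) : ℂ) • y u, hξ1, fun u hu => hclose u (hket 0) ?_,
    fun u hu => hclose u (by rw [norm_smul, hket]; simp) ?_,
    fun u hu => hclose u (by rw [norm_neg, hket]) ?_, fun ψ => ?_⟩
  · have := hright (x u) (hx1 u) hu.1
    simpa [ket, EuclideanSpace.inner_single_left, hy, hP0] using this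
  · have := hmid (x u) (hx1 u) hu.1 hu.2
    simpa [ket, EuclideanSpace.inner_single_left, hy, hP1, inner_smul_left] using this
  · have := hleft (x u) (hx1 u) hu.2
    have h2 : (inner ℂ (-ket 0) (y u)).re = -p₁.eval (x u) := by
      simp [ket, EuclideanSpace.inner_single_left, hy, hP0]
    rw [h2]; linarith
  · set T : ι → StateVec (Fin 2 × ((Qubits a × Qubits s) × (Fin 2 × Qubits 2))) := fun u =>
      Matrix.toEuclideanLin (c.toMatrix U) (gpeState a 2 (ket 0) (b u)) with hT
    have hTo : Orthonormal ℂ T := by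
      rw [orthonormal_iff_ite]
      intro u u'
      rw [hT, inner_toEuclideanLin_of_mem_unitaryGroup (c.toMatrix_mem_unitaryGroup U),
        inner_gpeState, inner_self_eq_norm_sq_to_K, hket, orthonormal_iff_ite.1 b.orthonormal]
      simp
    have hGo : Orthonormal ℂ fun u => gpeState a 2 (((‖y u‖⁻¹ : ℝ) : ℂ) • y u) (b u) := by
      rw [orthonormal_iff_ite]
      intro u u'
      rw [inner_gpeState, orthonormal_iff_ite.1 b.orthonormal]
      split_ifs with huu
      · subst huu
        rw [inner_self_eq_norm_sq_to_K, hξ1]; simp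
      · simp
    have hTapply (u : ι) (i : Fin 2) (j : Qubits s) : T u (0, ((0, j), (i, 0))) =
        gpeState a 2 (y u) (b u) (0, ((0, j), (i, 0))) := by
      rw [gpeState_apply, if_pos ⟨rfl, rfl, rfl⟩]
      exact hcU U (b u) (x u) (hB1 u) (hB2 u) i j
    have hGT (u u' : ι) : inner ℂ (gpeState a 2 (((‖y u‖⁻¹ : ℝ) : ℂ) • y u) (b u)) (T u') =
        if u = u' then (‖y u‖ : ℂ) else 0 := by
      have h1 : inner ℂ (gpeState a 2 (((‖y u‖⁻¹ : ℝ) : ℂ) • y u) (b u)) (T u') =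
          inner ℂ (gpeState a 2 (((‖y u‖⁻¹ : ℝ) : ℂ) • y u) (b u))
            (gpeState a 2 (y u') (b u')) := by
        rw [inner_gpeState_left, inner_gpeState_left]
        simp only [hTapply]
      rw [h1, inner_gpeState, orthonormal_iff_ite.1 b.orthonormal]
      split_ifs with huu
      · subst huu
        have : (‖y u‖ : ℂ) ≠ 0 := by exact_mod_cast (hypos u).ne'
        rw [inner_smul_left, inner_self_eq_norm_sq_to_K]
        simp
        field_simp
      · simp
    have hψ : Matrix.toEuclideanLin (c.toMatrix U) (gpeState a 2 (ket 0) ψ) =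
        ∑ u, inner ℂ (b u) ψ • T u := by
      have h1 : gpeState a 2 (ket 0) ψ =
          ∑ u, inner ℂ (b u) ψ • gpeState a 2 (ket 0) (b u) := by
        ext ⟨k, ⟨i, j⟩, m, ω⟩
        have h2 : ψ j = ∑ u, inner ℂ (b u) ψ * b u j := by
          conv_lhs => rw [← b.sum_repr' ψ]
          simp
        simp only [WithLp.ofLp_sum, WithLp.ofLp_smul, Finset.sum_apply, Pi.smul_apply,
          gpeState_apply, smul_eq_mul]
        split_ifs
        · rw [h2, Finset.mul_sum]
          exact Finset.sum_congr rfl fun u _ => by ring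
        · simp
      rw [h1, map_sum]
      simp only [map_smul, hT]
    rw [hψ]
    have hfin := norm_sum_sub_sum_sq_le hGo hTo hGT hylow fun u => inner ℂ (b u) ψ
    rw [b.sum_sq_norm_inner_right] at hfin
    refine abs_le_of_sq_le_sq' (hfin.trans ?_) (by positivity) |>.2
    rw [mul_pow]
    exact mul_le_mul_of_nonneg_right (by linarith) (sq_nonneg _)

theorem mainTheorem6 :
    ∃ C : ℝ, 0 < C ∧
      ∀ (φ ε : ℝ), 0 < φ → φ < 1 → 0 < ε → ∀ a s : ℕ,
        ∃ (w : ℕ) (c : QueryCircuit (Qubits a × Qubits s) (Fin 2 × Qubits w)),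
          (c.numQueries : ℝ) ≤ C * (1 / φ) * max 1 (Real.log (1 / ε)) ∧
          ∀ (U : Matrix.unitaryGroup (Qubits a × Qubits s) ℂ)
            (A : Matrix (Qubits s) (Qubits s) ℂ) (α : ℝ)
            (ι : Type) [Fintype ι] (ev : ι → ℝ)
            (b : OrthonormalBasis ι ℂ (StateVec (Qubits s))),
            A = ∑ u, (ev u : ℂ) • ketBra (b u) →
            IsBlockEncoding U A α 0 →
            2 * ‖A‖ ≤ α →
            ∃ ξ : ι → StateVec (Fin 2),
              (∀ u, ‖ξ u‖ = 1) ∧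
              (∀ u, ev u / α ∈ Set.Ico φ 1 → ‖ξ u - ket 0‖ ≤ ε) ∧
              (∀ u, ev u / α ∈ Set.Icc (-(φ / 2)) (φ / 2) →
                ‖ξ u - Complex.I • ket 1‖ ≤ ε) ∧
              (∀ u, ev u / α ∈ Set.Ioc (-1) (-φ) → ‖ξ u - (-ket 0)‖ ≤ ε) ∧
              ∀ ψ : StateVec (Qubits s),
                ‖Matrix.toEuclideanLin (c.toMatrix U) (gpeState a w (ket 0) ψ) -
                    ∑ u, inner ℂ (b u) ψ • gpeState a w (ξ u) (b u)‖ ≤ ε * ‖ψ‖ := by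
  refine ⟨300000, by norm_num, fun φ ε hφ hφ1 hε a s => ?_⟩
  set L := max 1 (Real.log (1 / ε)) with hL
  have hL1 : 1 ≤ L := le_max_left _ _
  set δ := min ε 1 with hδ
  have hδ0 : 0 < δ := lt_min hε one_pos
  have hδ1 : δ ≤ 1 := min_le_right _ _
  have hexpL : Real.exp (-L) ≤ δ := by
    refine le_min ?_ (Real.exp_le_one_iff.2 (by linarith))
    have : Real.log (1 / ε) ≤ L := le_max_right _ _
    rw [one_div, Real.log_inv] at this
    calc Real.exp (-L) ≤ Real.exp (Real.log ε) := Real.exp_le_exp.2 (by linarith)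
      _ = ε := Real.exp_log hε
  -- The path has accuracy `η = δ² / 8`; `n` is such that `4⁻ⁿ ≤ exp (-6 - 2 L) ≤ δ² / 224`.
  set n := ⌈6 + 2 * L⌉₊ with hn
  have hn1 : (6 + 2 * L : ℝ) ≤ n := Nat.le_ceil _
  have hn2 : (n : ℝ) ≤ 9 * L := by
    have := (Nat.ceil_lt_add_one (by linarith : 0 ≤ 6 + 2 * L)).le
    linarith
  have hnpos : 1 ≤ n := by
    have : (1 : ℝ) ≤ n := by linarith
    exact_mod_cast this
  have hpow : (1 / 4 : ℝ) ^ n ≤ δ ^ 2 / 224 := by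
    have h1 : (1 / 4 : ℝ) ≤ Real.exp (-1) := by
      rw [Real.exp_neg, one_div]
      exact inv_anti₀ (Real.exp_pos 1) (by linarith [Real.exp_one_lt_d9])
    have h6 : Real.exp (-6) ≤ 1 / 224 := by
      rw [Real.exp_neg, one_div]
      refine inv_anti₀ (by norm_num) ?_
      have : Real.exp 6 = Real.exp 1 ^ 6 := by rw [← Real.exp_nat_mul]; norm_num
      rw [this]
      calc (224 : ℝ) ≤ 2.7 ^ 6 := by norm_num
        _ ≤ Real.exp 1 ^ 6 := by gcongr; linarith [Real.exp_one_gt_d9]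
    calc (1 / 4 : ℝ) ^ n ≤ Real.exp (-1) ^ n := by gcongr
      _ = Real.exp (-n) := by rw [← Real.exp_nat_mul]; ring_nf
      _ ≤ Real.exp (-6 + (-L + -L)) := Real.exp_le_exp.2 (by linarith)
      _ = Real.exp (-6) * (Real.exp (-L) * Real.exp (-L)) := by rw [Real.exp_add, Real.exp_add]
      _ ≤ 1 / 224 * (δ * δ) := by gcongr
      _ = δ ^ 2 / 224 := by ring
  have hδε : δ ^ 2 ≤ ε ^ 2 := by
    have : δ ≤ ε := min_le_left _ _
    gcongr
  obtain ⟨c, hc, hc'⟩ := exists_gapped_phase_circuit (η := δ ^ 2 / 8) hφ hφ1 hε (by positivity)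
    (by nlinarith) (by linarith) hnpos (by linarith) a s
  refine ⟨2, c, hc.trans ?_, hc'⟩
  have h1 : (1 : ℝ) ≤ L / φ := by rw [le_div_iff₀ hφ]; linarith
  have h2 : 644 * (n : ℝ) / φ ≤ 5796 * (L / φ) := by
    rw [mul_div_assoc]
    have : (n : ℝ) / φ ≤ 9 * L / φ := by gcongr
    rw [mul_div_assoc] at this
    linarith
  have h3 : 300000 * (1 / φ) * L = 300000 * (L / φ) := by ring
  rw [h3]
  linarith
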